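/- **Setting.** Fix $n$ qubits. An $n$-qubit Pauli is $P=\alpha\,p_0\otimes\cdots\otimes p_{n-1}$ with $\alpha\in\{\pm1,\pm i\}$, $p_j\in\{I,X,Y,Z\}$; it is Hermitian iff $\alpha=\pm1$. A classical state $m$ is a partial assignment of booleans to classical variables, $m;c\gets b$ is the updated state, and a cq-state $\gamma$ is a function from a finite set of classical states to complex $2^n\times2^n$ matrices (extended by $0$). A *Pauli frame* $F$ consists of Hermitian Paulis $\tilde Z_j,\tilde X_j$ ($0\le j<n$) satisfying the commutation relations of the $Z_j,X_j$; with $\tilde Y_j=-i\tilde Z_j\tilde X_j$ it acts on Paulis by $\vec F(\alpha\,p_0\otimes\cdots\otimes p_{n-1})=\alpha\prod_j\tilde p_j$, its unitary $U_F$ (unique up to phase) is determined by $\vec F(P)=U_F^\dagger PU_F$, and $F_2\circ F_1$ has entries $\vec F_1$ of the entries of $F_2$. The frame of a Clifford unitary $U$ has entries $U^\dagger Z_jU$, $U^\dagger X_jU$. **Nodes** and their channels (acting on the matrix $\rho=\gamma(m)$, additively in $m$): * $\mathrm{Rot}(P,\theta)$, $P$ Hermitian: $\rho\mapsto e^{-i\theta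 P/2}\rho\, e^{i\theta P/2}$; * $\mathrm{Prep}(P_Z,P_X)$, $P_Z,P_X$ Hermitian and anticommuting: $\rho\mapsto\frac14\big((I+P_Z)\rho(I+P_Z)+P_X(I-P_Z)\rho(I-P_Z)P_X\big)$; * $\mathrm{Meas}^c(P)$, $P$ Hermitian: $\rho$ at $m$ contributes $\frac14(I+(-1)^bP)\rho(I+(-1)^bP)$ at $m;c\gets b$, for $b=0,1$; * a Pauli frame $F$: $\rho\mapsto U_F\rho U_F^\dagger$; * a measurement space function $\mu$ on classical states: $\gamma\mapsto\big(m_2\mapsto\sum_{\mu(m_1)=m_2}\gamma(m_1)\big)$. A *term* $n_0;n_1;\dots$ is a sequence of nodes; its channel applies the nodes from left to right. A frame acts on rotations, preparations and measurements by acting with $\vec F$ on their Pauli arguments. Two rotation/preparation/measurement nodes *commute* if all their Pauli arguments commute pairwise; a Pauli or such a node commutes with $F$ if $\vec F$ fixes its Paulis; two frames commute if $F\circ F'=F'\circ F$; a function $\mu$ commutes with rotations, preparations and frames, but not with measurements or other measurement space functions. A *PCOAST graph* is a finite directed acyclic graph whose vertices are nodes, with exactly one edge between two distinct non-commuting vertices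 and no edge between commuting ones. $G$ also denotes the term obtained by listing its vertices in any topological order. **Merge steps** $n_1;n_2\rightsquigarrow n_0$ or $n_0;\mu_0$: * $\mathrm{Rot}(P,\theta_1);\mathrm{Rot}(\pm P,\theta_2)\rightsquigarrow\mathrm{Rot}(P,\theta)$, $\theta=\theta_1\pm\theta_2$, or, if $\theta\in\frac\pi2\mathbb Z$, the frame of the Clifford $e^{-i\theta P/2}$; * $\mathrm{Prep}(P_Z,P_X);\mathrm{Prep}(\pm P_Z,P_X')\rightsquigarrow\mathrm{Prep}(\pm P_Z,P_X')$ if $P_X'\in\{P_X,-P_X\}$; * $\mathrm{Prep}(P_Z,P_X);\mathrm{Prep}(P_Z,P_X')\rightsquigarrow\mathrm{Prep}(P_Z,P_X)$; * $\mathrm{Prep}(P_Z,P_X);\mathrm{Rot}(\pm P_Z,\theta)\rightsquigarrow\mathrm{Prep}(P_Z,P_X)$; * $\mathrm{Meas}^{c_1}(P);\mathrm{Meas}^{c_2}((-1)^bP)\rightsquigarrow\mathrm{Meas}^{c_1}(P);\ c_2\gets c_1+b$; * $\mathrm{Prep}(P_Z,P_X);\mathrm{Meas}^{c}((-1)^bP_Z)\rightsquigarrow\mathrm{Prep}(P_Z,P_X);\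 c\gets b$; * $\mathrm{Rot}(\pm P,\theta);\mathrm{Meas}^c(P)\rightsquigarrow\mathrm{Meas}^c(P)$; * $F_1;F_2\rightsquigarrow F_2\circ F_1$ and $\mu_1;\mu_2\rightsquigarrow\mu_2\circ\mu_1$. **Procedures.** $\mathrm{addNode}(G,n)$ returns $(G,F,\mathrm{id})$ if $n$ is a frame $F$, and $(G,\text{identity frame},\mu)$ if $n$ is a function $\mu$. Otherwise, if some vertex $v$ of outdegree $0$ with node $n_v$ has a merge step from $n_v;n$ to $n_0$ or $n_0;\mu_0$ (put $\mu_0=\mathrm{id}$ in the first case), it picks such a merge (by an arbitrary search order), computes $(G'',F,\mu)=\mathrm{addNode}(G\setminus v,n_0)$ and returns $(G'',F,\mu_0\circ\mu)$; if there is none, it adds $n$ to $G$ as a new vertex, with an edge to it from every other vertex that does not commute with it, and returns this graph with the identity frame and $\mathrm{id}$. Let a *circuit* $C$ be a finite sequence of gates, each of which is a cq-channel on the program variables given as the channel of a PCOAST term; the channel of $C$ is the composite. $\mathrm{circuitToPoPR}(C)$ starts with $G=\emptyset$, $F$ the identity frame, $\mu=\mathrm{id}$, and processes the nodes $n$ of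 the terms of the gates in order. If $n=\mathrm{Meas}^c(P)$, it first replaces $n$ by $\mathrm{Meas}^{c'}(P)$ with $c'$ a fresh variable and $\mu$ by $m\mapsto(\mu(m);c\gets m(c'))$. If $n=\mu'$ it sets $\mu\gets\mu'\circ\mu$; if $n=F'$ it sets $F\gets F'\circ F$; otherwise it computes $(G',F',\mu')=\mathrm{addNode}(G,\vec F(n))$ and sets $G\gets G'$, $F\gets F\circ F'$, $\mu\gets\mu\circ\mu'$. Finally it returns $(G,F,\mu)$. **Theorem.** For every circuit $C$ (and every search order in $\mathrm{addNode}$), $\mathrm{circuitToPoPR}(C)$ terminates and returns a PCOAST graph $G$ all of whose vertices are rotations, preparations or measurements, a Pauli frame $F$ and a measurement space function $\mu$ such that $$C\equiv G;F;\mu ,$$ that is, for every topological order of $G$ (and there is one) and every cq-state, the output of $G;F;\mu$ and the output of $C$ are equal as cq-states on the program variables, after the values of the fresh variables are forgotten (summed over). -/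

import Mathlib

noncomputable section

namespace PCOAST

open Matrix

/-! ### Paulis -/

/-- Single-qubit Paulis. -/
inductive Pauli1
  | I | X | Y | Z
  deriving DecidableEq

instance : Fintype Pauli1 := ⟨{.I, .X, .Y, .Z}, fun p => by cases p <;> simp⟩

/-- Operators on `n` qubits; the computational basis states are the bit strings `Fin n → Fin 2`. -/
abbrev Op (n : ℕ) := Matrix (Fin n → Fin 2) (Fin n → Fin 2) ℂ

def Pauli1.toMat : Pauli1 → Matrix (Fin 2) (Fin 2) ℂ
  | .I => 1
  | .X => !![0, 1; 1, 0]
  | .Y => !![0, -Complex.I; Complex.I, 0]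
  | .Z => !![1, 0; 0, -1]

/-- The product of two single-qubit Paulis is `i ^ k` times a single-qubit Pauli `r`;
this is the pair `(k, r)`. -/
def Pauli1.mul : Pauli1 → Pauli1 → ZMod 4 × Pauli1
  | .I, q => (0, q)
  | p, .I => (0, p)
  | .X, .X => (0, .I)
  | .Y, .Y => (0, .I)
  | .Z, .Z => (0, .I)
  | .X, .Y => (1, .Z)
  | .Y, .Z => (1, .X)
  | .Z, .X => (1, .Y)
  | .Y, .X => (3, .Z)
  | .Z, .Y => (3, .X)
  | .X, .Z => (3, .Y)

/-- `0` if the two single-qubit Paulis commute, `1` if they anticommute. -/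
def Pauli1.lam (p q : Pauli1) : ℕ :=
  if p = .I ∨ q = .I ∨ p = q then 0 else 1

/-- The `n`-qubit Pauli `i ^ phase • (str 0 ⊗ ⋯ ⊗ str (n-1))`. -/
@[ext]
structure Pauli (n : ℕ) where
  phase : ZMod 4
  str : Fin n → Pauli1

namespace Pauli

variable {n : ℕ}

def toMat (P : Pauli n) : Op n :=
  Complex.I ^ P.phase.val • Matrix.of fun a b => ∏ j, (P.str j).toMat (a j) (b j)

instance : One (Pauli n) := ⟨⟨0, fun _ => .I⟩⟩

instance : Mul (Pauli n) :=
  ⟨fun P Q => ⟨P.phase + Q.phase + ∑ j, ((P.str j).mul (Q.str j)).1,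
    fun j => ((P.str j).mul (Q.str j)).2⟩⟩

/-- Multiplication by the scalar `i ^ k`. -/
def scale (k : ZMod 4) (P : Pauli n) : Pauli n := ⟨k + P.phase, P.str⟩

/-- `(-1) ^ b • P`. -/
def signed (b : Bool) (P : Pauli n) : Pauli n := scale (if b then 2 else 0) P

/-- The commutativity function: `P * Q = (-1) ^ lam P Q • Q * P`. -/
def lam (P Q : Pauli n) : ℕ := (∑ j, (P.str j).lam (Q.str j)) % 2

/-- `P` and `Q` commute. -/
def Comm (P Q : Pauli n) : Prop := lam P Q = 0

/-- A Pauli is Hermitian iff its coefficient is `1` or `-1`. -/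
def Herm (P : Pauli n) : Prop := P.phase = 0 ∨ P.phase = 2

/-- The Hermitian product `(-i) ^ lam P Q • P * Q`. -/
def hprod (P Q : Pauli n) : Pauli n := scale (3 * (lam P Q : ZMod 4)) (P * Q)

/-- The Pauli that is `p` on qubit `j` and the identity elsewhere. -/
def single (j : Fin n) (p : Pauli1) : Pauli n := ⟨0, Function.update (fun _ => .I) j p⟩

end Pauli

/-! ### Pauli frames -/

/-- An `n × 2` array of Paulis: the effective `Z_j` and the effective `X_j`. -/
@[ext]
structure Frame (n : ℕ) where
  effZ : Fin n → Pauli n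
  effX : Fin n → Pauli n

namespace Frame

variable {n : ℕ}

/-- The array is a Pauli frame: its entries are Hermitian and satisfy the commutation relations
of the `Z_j` and `X_j`. -/
def WF (F : Frame n) : Prop :=
  (∀ j, (F.effZ j).Herm ∧ (F.effX j).Herm) ∧
  ∀ i j, Pauli.lam (F.effZ i) (F.effZ j) = 0 ∧ Pauli.lam (F.effX i) (F.effX j) = 0 ∧
    Pauli.lam (F.effZ i) (F.effX j) = if i = j then 1 else 0

/-- The effective entry of a single-qubit Pauli at qubit `j`. -/
def eff (F : Frame n) (j : Fin n) : Pauli1 → Pauli n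
  | .I => 1
  | .X => F.effX j
  | .Y => Pauli.hprod (F.effZ j) (F.effX j)
  | .Z => F.effZ j

/-- The lookup action of a frame on a Pauli. -/
def act (F : Frame n) (P : Pauli n) : Pauli n :=
  Pauli.scale P.phase (List.ofFn fun j => F.eff j (P.str j)).prod

/-- The origin frame, i.e. the frame of the identity. -/
def origin : Frame n := ⟨fun j => .single j .Z, fun j => .single j .X⟩

/-- `F₂.comp F₁` is the composition `F₂ ∘ F₁` (`F₁` acts first on states). -/
def comp (F₂ F₁ : Frame n) : Frame n :=
  ⟨fun j => F₁.act (F₂.effZ j), fun j => F₁.act (F₂.effX j)⟩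

/-- The inverse frame: the Pauli frame `F'` with `F' ∘ F` the origin frame. -/
def inv (F : Frame n) : Frame n :=
  @Classical.epsilon _ ⟨origin⟩ fun F' : Frame n => F'.WF ∧ F'.comp F = origin

/-- `U` is a Clifford unitary of the frame: `F.act P = U† P U` for every Pauli `P`. -/
def IsUnitaryOf (F : Frame n) (U : Op n) : Prop :=
  U ∈ Matrix.unitaryGroup (Fin n → Fin 2) ℂ ∧ ∀ P, (F.act P).toMat = Uᴴ * P.toMat * U

/-- The unitary of a Pauli frame (it is determined up to an overall phase). -/
def unitary (F : Frame n) : Op n := Classical.epsilon F.IsUnitaryOf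

/-- `F` is the frame of the Clifford unitary `U`: its entries are `U† Z_j U` and `U† X_j U`. -/
def IsFrameOf (F : Frame n) (U : Op n) : Prop :=
  ∀ j, (F.effZ j).toMat = Uᴴ * (Pauli.single j .Z).toMat * U ∧
    (F.effX j).toMat = Uᴴ * (Pauli.single j .X).toMat * U

end Frame

/-! ### Classical states and classical-quantum states -/

/-- A classical state: a (partial) assignment of booleans to the classical variables `κ`. -/
abbrev ClState (κ : Type*) := κ → Option Bool

/-- A cq-state: a function to operators from some finite set of classical states
(extended by `0`). Positivity and normalisation are not imposed, so that an equality of channels on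
all of `CQ n κ` is in particular an equality on all physical cq-states. -/
abbrev CQ (n : ℕ) (κ : Type*) := ClState κ →₀ Op n

/-- A measurement space function acting on one variable set. -/
abbrev MFun (κ : Type*) := ClState κ → ClState κ

/-- The channel of a measurement space function `f`:
it sends `γ` to `m₂ ↦ ∑_{m₁ ∈ f⁻¹(m₂)} γ m₁`. -/
def muChan {n : ℕ} {κ κ' : Type*} (f : ClState κ → ClState κ') (γ : CQ n κ) : CQ n κ' :=
  Finsupp.mapDomain f γ

/-- The classical state `m; c ← v`. -/
def assign {κ : Type*} [DecidableEq κ] (m : ClState κ) (c : κ) (v : Option Bool) : ClState κ :=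
  Function.update m c v

/-! ### PCOAST nodes and terms -/

/-- PCOAST nodes on `n` qubits with classical variables `κ`. -/
inductive Node (n : ℕ) (κ : Type*)
  /-- the rotation `exp (- i θ / 2 P)` -/
  | rot (P : Pauli n) (θ : ℝ)
  /-- the preparation of `P_Z`, corrected by `P_X` -/
  | prep (PZ PX : Pauli n)
  /-- the measurement of `P`, recorded in `c` -/
  | meas (c : κ) (P : Pauli n)
  /-- a Pauli frame -/
  | frame (F : Frame n)
  /-- a measurement space function -/
  | mu (μ : MFun κ)

/-- A PCOAST term `n₀; n₁; …` -/
abbrev Term (n : ℕ) (κ : Type*) := List (Node n κ)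

/-- The unitary `exp (- i θ / 2 P) = cos (θ / 2) I - i sin (θ / 2) P` (for Hermitian `P`). -/
def rotMat {n : ℕ} (P : Pauli n) (θ : ℝ) : Op n :=
  (Real.cos (θ / 2) : ℂ) • (1 : Op n) - (Complex.I * (Real.sin (θ / 2) : ℂ)) • P.toMat

namespace Node

variable {n : ℕ} {κ : Type*}

/-- The arguments satisfy the conditions in the definition of a PCOAST node. -/
def WF : Node n κ → Prop
  | .rot P _ => P.Herm
  | .prep PZ PX => PZ.Herm ∧ PX.Herm ∧ Pauli.lam PZ PX = 1
  | .meas _ P => P.Herm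
  | .frame F => F.WF
  | .mu _ => True

/-- Rotations, preparations and measurements. -/
def IsPauliNode : Node n κ → Prop
  | .frame _ => False
  | .mu _ => False
  | _ => True

/-- The cq-channel of a node. -/
def sem [DecidableEq κ] : Node n κ → CQ n κ → CQ n κ
  | .rot P θ, γ => γ.mapRange (fun ρ => rotMat P θ * ρ * rotMat P (-θ)) (by simp)
  | .prep PZ PX, γ => γ.mapRange (fun ρ => (1 / 4 : ℂ) •
      ((1 + PZ.toMat) * ρ * (1 + PZ.toMat) +
        PX.toMat * (1 - PZ.toMat) * ρ * (1 - PZ.toMat) * PX.toMat)) (by simp)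
  | .meas c P, γ => γ.sum fun m ρ =>
      Finsupp.single (assign m c (some false))
        ((1 / 4 : ℂ) • ((1 + P.toMat) * ρ * (1 + P.toMat))) +
      Finsupp.single (assign m c (some true))
        ((1 / 4 : ℂ) • ((1 - P.toMat) * ρ * (1 - P.toMat)))
  | .frame F, γ => γ.mapRange (fun ρ => F.unitary * ρ * F.unitaryᴴ) (by simp)
  | .mu μ, γ => muChan μ γ

/-- A Pauli commutes with a node. -/
def PauliComm (Q : Pauli n) : Node n κ → Prop
  | .rot P _ => Q.Comm P
  | .prep PZ PX => Q.Comm PZ ∧ Q.Comm PX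
  | .meas _ P => Q.Comm P
  | .frame F => F.act Q = Q
  | .mu _ => True

/-- The (syntactic) commutation relation between nodes. -/
def Comm : Node n κ → Node n κ → Prop
  | .meas _ _, .mu _ => False
  | .rot P _, n₂ => PauliComm P n₂
  | .prep PZ PX, n₂ => PauliComm PZ n₂ ∧ PauliComm PX n₂
  | .meas _ P, n₂ => PauliComm P n₂
  | .frame F, .frame F' => F.comp F' = F'.comp F
  | .frame F, .rot P _ => F.act P = P
  | .frame F, .prep PZ PX => F.act PZ = PZ ∧ F.act PX = PX
  | .frame F, .meas _ P => F.act P = P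
  | .frame _, .mu _ => True
  | .mu _, .rot _ _ => True
  | .mu _, .prep _ _ => True
  | .mu _, .frame _ => True
  | .mu _, .meas _ _ => False
  | .mu _, .mu _ => False

/-- The lookup action of a frame on a node, with `F; n ≡ (fwd F n); F`. -/
def fwd (F : Frame n) : Node n κ → Node n κ
  | .rot P θ => .rot (F.act P) θ
  | .prep PZ PX => .prep (F.act PZ) (F.act PX)
  | .meas c P => .meas c (F.act P)
  | .frame F' => .frame ((F.inv.comp F').comp F)
  | .mu μ => .mu μ

end Node

/-- The cq-channel of a term. -/
def termSem {n : ℕ} {κ : Type*} [DecidableEq κ] (t : Term n κ) (γ : CQ n κ) : CQ n κ :=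
  t.foldl (fun δ nd => nd.sem δ) γ

/-! ### Merging -/

/-- `MergeStep n₁ n₂ n₀ μ₀` is the merge step from `n₁; n₂` to `n₀; μ₀`, where `μ₀ = id` stands for
a step to the single node `n₀`. -/
inductive MergeStep {n : ℕ} {κ : Type*} [DecidableEq κ] :
    Node n κ → Node n κ → Node n κ → MFun κ → Prop
  | rotRotClifford (P : Pauli n) (b : Bool) (θ₁ θ₂ θ : ℝ) (F : Frame n)
      (hθ : θ = if b then θ₁ - θ₂ else θ₁ + θ₂)
      (hk : ∃ k : ℤ, θ = k * (Real.pi / 2)) (hF : F.IsFrameOf (rotMat P θ)) :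
      MergeStep (.rot P θ₁) (.rot (P.signed b) θ₂) (.frame F) id
  | rotRot (P : Pauli n) (b : Bool) (θ₁ θ₂ θ : ℝ)
      (hθ : θ = if b then θ₁ - θ₂ else θ₁ + θ₂)
      (hk : ¬ ∃ k : ℤ, θ = k * (Real.pi / 2)) :
      MergeStep (.rot P θ₁) (.rot (P.signed b) θ₂) (.rot P θ) id
  | prepPrep (PZ PX : Pauli n) (b b' : Bool) :
      MergeStep (.prep PZ PX) (.prep (PZ.signed b) (PX.signed b'))
        (.prep (PZ.signed b) (PX.signed b')) id
  | prepPrepSame (PZ PX PX' : Pauli n) :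
      MergeStep (.prep PZ PX) (.prep PZ PX') (.prep PZ PX) id
  | prepRot (PZ PX : Pauli n) (b : Bool) (θ : ℝ) :
      MergeStep (.prep PZ PX) (.rot (PZ.signed b) θ) (.prep PZ PX) id
  | measMeas (c₁ c₂ : κ) (P : Pauli n) (b : Bool) :
      MergeStep (.meas c₁ P) (.meas c₂ (P.signed b)) (.meas c₁ P)
        (fun m => assign m c₂ ((m c₁).map fun x => xor x b))
  | prepMeas (PZ PX : Pauli n) (c : κ) (b : Bool) :
      MergeStep (.prep PZ PX) (.meas c (PZ.signed b)) (.prep PZ PX)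
        (fun m => assign m c (some b))
  | rotMeas (P : Pauli n) (b : Bool) (θ : ℝ) (c : κ) :
      MergeStep (.rot (P.signed b) θ) (.meas c P) (.meas c P) id
  | frameFrame (F₁ F₂ : Frame n) :
      MergeStep (.frame F₁) (.frame F₂) (.frame (F₂.comp F₁)) id
  | muMu (μ₁ μ₂ : MFun κ) :
      MergeStep (.mu μ₁) (.mu μ₂) (.mu (μ₂ ∘ μ₁)) id

/-! ### PCOAST graphs -/

/-- A finite directed graph with vertices (names in `ℕ`) labelled by PCOAST nodes.
The values of `label` off `verts` are irrelevant. -/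
structure Graph (n : ℕ) (κ : Type*) where
  verts : Finset ℕ
  label : ℕ → Node n κ
  edges : Set (ℕ × ℕ)

namespace Graph

variable {n : ℕ} {κ : Type*}

/-- `G` is a PCOAST graph: a directed acyclic graph of PCOAST nodes, with exactly one edge between
two different vertices that do not commute, and no edge between vertices that commute. -/
def IsPCOAST (G : Graph n κ) : Prop :=
  (∀ v ∈ G.verts, (G.label v).WF) ∧
  (∀ e ∈ G.edges, e.1 ∈ G.verts ∧ e.2 ∈ G.verts) ∧
  (∀ v, ¬ Relation.TransGen (fun a b => (a, b) ∈ G.edges) v v) ∧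
  ∀ v ∈ G.verts, ∀ w ∈ G.verts, v ≠ w →
    (¬ (G.label v).Comm (G.label w) → Xor ((v, w) ∈ G.edges) ((w, v) ∈ G.edges)) ∧
    ((G.label v).Comm (G.label w) → (v, w) ∉ G.edges ∧ (w, v) ∉ G.edges)

/-- `l` is a topological ordering of the vertices of `G`. -/
def IsTopOrder (G : Graph n κ) (l : List ℕ) : Prop :=
  l.Nodup ∧ (∀ v, v ∈ l ↔ v ∈ G.verts) ∧ l.Pairwise fun v w => (w, v) ∉ G.edges

/-- The term that lists the nodes of `G` in the order `l`. -/
def termOf (G : Graph n κ) (l : List ℕ) : Term n κ := l.map G.label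

def empty : Graph n κ := ⟨∅, fun _ => .mu id, ∅⟩

/-- Removal of a vertex and its edges. -/
def remove (G : Graph n κ) (v : ℕ) : Graph n κ :=
  ⟨G.verts.erase v, G.label, {e | e ∈ G.edges ∧ e.1 ≠ v ∧ e.2 ≠ v}⟩

/-- A name for a new vertex. -/
def newVertex (G : Graph n κ) : ℕ := G.verts.sup id + 1

/-- Addition of a new vertex `nd`, with edges to it from the vertices that do not commute with
it. -/
def insert (G : Graph n κ) (nd : Node n κ) : Graph n κ :=
  ⟨Insert.insert G.newVertex G.verts, Function.update G.label G.newVertex nd,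
    G.edges ∪ {e | e.1 ∈ G.verts ∧ e.2 = G.newVertex ∧ ¬ (G.label e.1).Comm nd}⟩

/-- `v` is a vertex of outdegree `0` whose node merges with `nd` into `n₀; μ₀`. -/
def MergesAt [DecidableEq κ] (G : Graph n κ) (nd : Node n κ) (v : ℕ) (n₀ : Node n κ)
    (μ₀ : MFun κ) : Prop :=
  v ∈ G.verts ∧ (∀ w, (v, w) ∉ G.edges) ∧ MergeStep (G.label v) nd n₀ μ₀

end Graph

/-! ### The compilation procedure -/

/-- An order in which the loop over the vertices of outdegree `0` is executed, represented by the
first merge that the loop finds, or `none` if there is no possible merge. -/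
structure MergeSearch (n : ℕ) (κ : Type*) [DecidableEq κ] where
  pick : Graph n κ → Node n κ → Option (ℕ × Node n κ × MFun κ)
  some_spec : ∀ G nd v n₀ μ₀, pick G nd = some (v, n₀, μ₀) → G.MergesAt nd v n₀ μ₀
  none_spec : ∀ G nd, pick G nd = none → ∀ v n₀ μ₀, ¬ G.MergesAt nd v n₀ μ₀

instance {n : ℕ} {κ : Type*} [DecidableEq κ] : Nonempty (MergeSearch n κ) := by
  classical
  refine ⟨⟨fun G nd => if h : ∃ x : ℕ × Node n κ × MFun κ, G.MergesAt nd x.1 x.2.1 x.2.2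
    then some h.choose else none, ?_, ?_⟩⟩
  · intro G nd v n₀ μ₀ h
    split at h
    · next hx =>
      have h' := hx.choose_spec
      rw [Option.some.inj h] at h'
      exact h'
    · exact absurd h (by simp)
  · intro G nd h v n₀ μ₀ hm
    split at h
    · exact absurd h (by simp)
    · next hx => exact hx ⟨(v, n₀, μ₀), hm⟩

/-- The procedure `addNode G nd`; it returns a graph, a frame and a measurement space function. -/
def addNode {n : ℕ} {κ : Type*} [DecidableEq κ] (S : MergeSearch n κ) (G : Graph n κ)
    (nd : Node n κ) : Graph n κ × Frame n × MFun κ :=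
  match nd with
  | .frame F => (G, F, id)
  | .mu μ => (G, Frame.origin, μ)
  | nd =>
    match _h : S.pick G nd with
    | some (v, n₀, μ₀) =>
      let r := addNode S (G.remove v) n₀
      (r.1, r.2.1, μ₀ ∘ r.2.2)
    | none => (G.insert nd, Frame.origin, id)
termination_by G.verts.card
decreasing_by exact Finset.card_erase_lt_of_mem (S.some_spec _ _ _ _ _ _h).1

/-- The state of the compilation loop: the graph, the frame and the measurement space function built
so far. The compiled code uses the program variables `ν` and fresh variables `ℕ`, of which those
below `next` have been used. -/
structure Config (n : ℕ) (ν : Type*) where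
  graph : Graph n (ν ⊕ ℕ)
  frame : Frame n
  mfun : MFun (ν ⊕ ℕ)
  next : ℕ

/-- A measurement space function on the program variables, acting on all variables. -/
def liftMFun {ν : Type*} (μ : MFun ν) : MFun (ν ⊕ ℕ) := fun m =>
  Sum.elim (μ fun c => m (Sum.inl c)) fun k => m (Sum.inr k)

/-- The measurement space function `μ[c ↦ c']`, i.e. `m ↦ μ(m); c ← m(c')`. -/
def redirect {κ : Type*} [DecidableEq κ] (μ : MFun κ) (c c' : κ) : MFun κ :=
  fun m => assign (μ m) c (m c')

section

variable {n : ℕ} {ν : Type*} [DecidableEq ν]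

/-- Add a rotation, preparation or measurement to the state: push it through the frame, add it to the
graph, and absorb the returned frame and measurement space function. -/
def Config.add (S : MergeSearch n (ν ⊕ ℕ)) (s : Config n ν) (nd : Node n (ν ⊕ ℕ)) : Config n ν :=
  let r := addNode S s.graph (nd.fwd s.frame)
  ⟨r.1, s.frame.comp r.2.1, s.mfun ∘ r.2.2, s.next⟩

/-- The body of the compilation loop. -/
def Config.step (S : MergeSearch n (ν ⊕ ℕ)) (s : Config n ν) : Node n ν → Config n ν
  | .rot P θ => s.add S (.rot P θ)
  | .prep PZ PX => s.add S (.prep PZ PX)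
  | .meas c P =>
      Config.add S ⟨s.graph, s.frame, redirect s.mfun (Sum.inl c) (Sum.inr s.next), s.next + 1⟩
        (.meas (Sum.inr s.next) P)
  | .frame F' => ⟨s.graph, F'.comp s.frame, s.mfun, s.next⟩
  | .mu μ' => ⟨s.graph, s.frame, liftMFun μ' ∘ s.mfun, s.next⟩

/-- The compilation procedure `circuitToPoPR`, for circuits over gates `g` that are written as
PCOAST terms `gateTerm g`. -/
def circuitToPoPR {Γ : Type*} (S : MergeSearch n (ν ⊕ ℕ)) (gateTerm : Γ → Term n ν)
    (C : List Γ) : Config n ν :=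
  C.foldl (fun s g => (gateTerm g).foldl (fun s nd => s.step S nd) s)
    ⟨Graph.empty, Frame.origin, id, 0⟩

/-- The cq-channel of a circuit whose gates have the cq-channels `chan g`. -/
def circuitSem {Γ : Type*} (chan : Γ → CQ n ν → CQ n ν) (C : List Γ) (γ : CQ n ν) : CQ n ν :=
  C.foldl (fun δ g => chan g δ) γ

/-- The (well-formed) term `t` describes the cq-channel `Φ`. -/
def Represents (t : Term n ν) (Φ : CQ n ν → CQ n ν) : Prop :=
  (∀ nd ∈ t, nd.WF) ∧ ∀ γ, Φ γ = termSem t γ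

/-- Forget the values of the fresh variables. -/
def dropFresh (m : ClState (ν ⊕ ℕ)) : ClState ν := fun c => m (Sum.inl c)

/-- A channel `Φ` on the program variables is equivalent to a term `t` that uses fresh variables in
addition: after forgetting the fresh variables, `Φ` and `t` give the same cq-state. -/
def EquivModFresh (Φ : CQ n ν → CQ n ν) (t : Term n (ν ⊕ ℕ)) : Prop :=
  ∀ δ : CQ n (ν ⊕ ℕ), Φ (muChan dropFresh δ) = muChan dropFresh (termSem t δ)

end

end PCOAST

end

/-!
The compiled code is compared with the circuit node by node, so the argument rests on four facts
about channels.

*Frames.* A Pauli frame acts multiplicatively on Paulis (`Frame.toMat_act_mul`), and every such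
action is conjugation by a unitary (`Frame.exists_isUnitaryOf`). The unitary is found by averaging
`F(s) M s` over all Paulis `s`: the average intertwines the Paulis with their images under `F`, and
a matrix commuting with all Paulis is a scalar (`Pauli.eq_smul_one_of_commute`). The same form of
Schur's lemma shows that the unitary is unique up to a phase, so the channel of a frame may be
computed with any of its unitaries (`sem_frame`). Consequently frames compose (`sem_frame_comp`), a
node can be moved in front of a frame (`sem_fwd`), and a rotation that is Clifford is the channel of
its frame (`sem_rot_eq_frame`).

*Commutation.* The channel of a rotation, preparation or measurement is a sum of maps `ρ ↦ A ρ B`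
with `A` and `B` in the algebra generated by the Pauli arguments, so nodes with commuting arguments
have commuting channels, provided that they do not write the same variable (`Node.sem_comm`).

*Merging.* Each merge step comes down to identities between the projections `(1 ± P) / 2` and the
rotations of `P`, which act on the ranges of these projections as scalars (`MergeStep.sound`).

*Fresh variables.* The measurement space function built so far does not read unused fresh variables,
hence a measurement after it can be replaced by a measurement into a fresh variable before it
(`sem_meas_redirect`). Since each measurement of the graph has its own variable, `Node.sem_comm`
applies to the graph.

The specification `AddNodeSpec` of `addNode` says that every topological order `l'` of the new graph
comes from some topological order `l` of the old one with the same channel after adding the node.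
In the case of a merge, `l` lists the merged vertex last; in the case of an insertion, `l` is `l'`
without the new vertex, which commutes with everything listed after it. The loop invariant
`Config.Inv` quantifies over all topological orders, and is preserved because such an `l` exists.
-/

noncomputable section

namespace PCOAST

open Matrix

/-! ### Algebra of Paulis -/

theorem I_pow_val_add (a b : ZMod 4) :
    Complex.I ^ (a + b).val = Complex.I ^ a.val * Complex.I ^ b.val := by
  rw [ZMod.val_add, ← Complex.I_pow_eq_pow_mod, pow_add]

theorem I_pow_val_sum {ι : Type*} (s : Finset ι) (f : ι → ZMod 4) :
    Complex.I ^ (∑ j ∈ s, f j).val = ∏ j ∈ s, Complex.I ^ (f j).val := by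
  classical
  induction s using Finset.induction_on with
  | empty => simp
  | insert a s ha ih => rw [Finset.sum_insert ha, Finset.prod_insert ha, I_pow_val_add, ih]

theorem zmod_four_val_two : (2 : ZMod 4).val = 2 := rfl

theorem zmod_four_val_three : (3 : ZMod 4).val = 3 := rfl

theorem I_pow_val_two_mul (a : ℕ) : Complex.I ^ (2 * (a : ZMod 4)).val = (-1) ^ a := by
  have h : (2 * (a : ZMod 4)) = ((2 * a : ℕ) : ZMod 4) := by push_cast; rfl
  rw [h, ZMod.val_natCast, ← Complex.I_pow_eq_pow_mod, pow_mul, Complex.I_sq]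

theorem Pauli1.toMat_mul (p q : Pauli1) :
    p.toMat * q.toMat = Complex.I ^ (p.mul q).1.val • (p.mul q).2.toMat := by
  cases p <;> cases q <;>
    simp [Pauli1.toMat, Pauli1.mul, ZMod.val_one'', zmod_four_val_three, Complex.I_pow_three,
      Matrix.one_fin_two]

theorem Pauli1.toMat_conjTranspose (p : Pauli1) : p.toMatᴴ = p.toMat := by
  cases p <;> ext i j <;> fin_cases i <;> fin_cases j <;> simp [Pauli1.toMat]

theorem Pauli1.trace_toMat (p : Pauli1) (hp : p ≠ .I) : p.toMat.trace = 0 := by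
  cases p <;> simp_all [Pauli1.toMat, Matrix.trace_fin_two]

/-- The completeness relation of the Pauli basis on one qubit. -/
theorem Pauli1.sum_toMat_mul_toMat (a i b j : Fin 2) :
    ∑ p : Pauli1, p.toMat i a * p.toMat b j = if a = b ∧ i = j then 2 else 0 := by
  have h : (Finset.univ : Finset Pauli1) = {.I, .X, .Y, .Z} := rfl
  rw [h]
  fin_cases a <;> fin_cases i <;> fin_cases b <;> fin_cases j <;>
    simp [Pauli1.toMat] <;> norm_num

theorem Pauli1.mul_comm_snd (p q : Pauli1) : (p.mul q).2 = (q.mul p).2 := by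
  cases p <;> cases q <;> rfl

theorem Pauli1.mul_comm_fst (p q : Pauli1) :
    (p.mul q).1 = (q.mul p).1 + 2 * (p.lam q : ZMod 4) := by
  cases p <;> cases q <;> decide

theorem Pauli1.mul_self (p : Pauli1) : p.mul p = (0, .I) := by
  cases p <;> rfl

theorem Pauli1.I_mul (p : Pauli1) : Pauli1.mul .I p = (0, p) := by
  cases p <;> rfl

theorem Pauli1.mul_I (p : Pauli1) : Pauli1.mul p .I = (0, p) := by
  cases p <;> rfl

theorem Pauli1.mul_mul_self_snd (p q : Pauli1) : (p.mul (p.mul q).2).2 = q := by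
  cases p <;> cases q <;> rfl

theorem Pauli1.lam_comm (p q : Pauli1) : p.lam q = q.lam p := by
  cases p <;> cases q <;> rfl

namespace Pauli

variable {n : ℕ}

@[simp] theorem mul_phase (P Q : Pauli n) :
    (P * Q).phase = P.phase + Q.phase + ∑ j, ((P.str j).mul (Q.str j)).1 := rfl

@[simp] theorem mul_str (P Q : Pauli n) (j : Fin n) :
    (P * Q).str j = ((P.str j).mul (Q.str j)).2 := rfl

theorem toMat_apply (P : Pauli n) (a b : Fin n → Fin 2) :
    P.toMat a b = Complex.I ^ P.phase.val * ∏ j, (P.str j).toMat (a j) (b j) := rfl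

theorem toMat_mul (P Q : Pauli n) : (P * Q).toMat = P.toMat * Q.toMat := by
  ext a c
  have h : ∀ j, ∑ x, (P.str j).toMat (a j) x * (Q.str j).toMat x (c j) =
      Complex.I ^ ((P.str j).mul (Q.str j)).1.val * ((P * Q).str j).toMat (a j) (c j) := by
    intro j
    have := congrFun (congrFun (Pauli1.toMat_mul (P.str j) (Q.str j)) (a j)) (c j)
    rwa [Matrix.mul_apply] at this
  rw [Matrix.mul_apply]
  simp only [toMat_apply]
  rw [mul_phase, I_pow_val_add, I_pow_val_add, I_pow_val_sum]
  calc _ = Complex.I ^ P.phase.val * Complex.I ^ Q.phase.val *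
        ∏ j, ∑ x, (P.str j).toMat (a j) x * (Q.str j).toMat x (c j) := by
        simp only [h, Finset.prod_mul_distrib]; ring
    _ = _ := by
        rw [Finset.prod_univ_sum, Fintype.piFinset_univ, Finset.mul_sum]
        refine Finset.sum_congr rfl fun x _ => ?_
        rw [Finset.prod_mul_distrib]; ring

@[simp] theorem toMat_one : (1 : Pauli n).toMat = 1 := by
  ext a b
  change Complex.I ^ (0 : ZMod 4).val * ∏ j, (1 : Matrix (Fin 2) (Fin 2) ℂ) (a j) (b j) = _
  by_cases h : a = b
  · subst h; simp
  · obtain ⟨j, hj⟩ := Function.ne_iff.mp h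
    rw [Matrix.one_apply_ne h, Finset.prod_eq_zero (Finset.mem_univ j) (by simp [hj]), mul_zero]

@[simp] theorem toMat_scale (k : ZMod 4) (P : Pauli n) :
    (scale k P).toMat = Complex.I ^ k.val • P.toMat := by
  ext a b
  simp only [toMat_apply, scale, Matrix.smul_apply, smul_eq_mul, I_pow_val_add, mul_assoc]

theorem toMat_signed (b : Bool) (P : Pauli n) :
    (P.signed b).toMat = if b then -P.toMat else P.toMat := by
  cases b <;> simp [signed, zmod_four_val_two]

theorem toMat_list_prod (l : List (Pauli n)) : l.prod.toMat = (l.map toMat).prod := by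
  induction l with
  | nil => simp
  | cons P l ih => simp [toMat_mul, ih]

theorem mul_eq_scale_mul (P Q : Pauli n) : P * Q = scale (2 * (lam P Q : ZMod 4)) (Q * P) := by
  have h : (2 * ((lam P Q : ℕ) : ZMod 4)) = ∑ j, 2 * ((P.str j).lam (Q.str j) : ZMod 4) := by
    rw [← Finset.mul_sum, ← Nat.cast_sum, lam]
    have h4 : ∀ k : ℕ, 2 * ((k % 2 : ℕ) : ZMod 4) = 2 * (k : ZMod 4) := by
      intro k
      have : ((2 * (k % 2) : ℕ) : ZMod 4) = ((2 * k : ℕ) : ZMod 4) := by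
        rw [ZMod.natCast_eq_natCast_iff']; omega
      simpa using this
    exact h4 _
  ext j
  · simp only [mul_phase, scale, h, Pauli1.mul_comm_fst (P.str _), Finset.sum_add_distrib]
    ring
  · exact Pauli1.mul_comm_snd _ _

theorem toMat_mul_toMat_comm (P Q : Pauli n) :
    P.toMat * Q.toMat = (-1 : ℂ) ^ lam P Q • (Q.toMat * P.toMat) := by
  rw [← toMat_mul, ← toMat_mul, mul_eq_scale_mul P Q, toMat_scale, I_pow_val_two_mul]

theorem lam_comm (P Q : Pauli n) : lam P Q = lam Q P := by
  simp only [lam, Pauli1.lam_comm (P.str _)]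

theorem lam_lt_two (P Q : Pauli n) : lam P Q < 2 := Nat.mod_lt _ two_pos

theorem commute_of_comm {P Q : Pauli n} (h : lam P Q = 0) : Commute P.toMat Q.toMat := by
  have := toMat_mul_toMat_comm P Q
  rw [h, pow_zero, one_smul] at this
  exact this

theorem toMat_anticomm {P Q : Pauli n} (h : lam P Q = 1) :
    P.toMat * Q.toMat = -(Q.toMat * P.toMat) := by
  have := toMat_mul_toMat_comm P Q
  rw [h] at this
  simpa using this

/-- The Pauli with coefficient `1` and the given letters. -/
def ofStr (s : Fin n → Pauli1) : Pauli n := ⟨0, s⟩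

theorem eq_scale_ofStr (P : Pauli n) : P = scale P.phase (ofStr P.str) := by
  ext j <;> simp [scale, ofStr]

theorem ofStr_mul_self (s : Fin n → Pauli1) : ofStr s * ofStr s = ofStr fun _ => .I := by
  ext j <;> simp [ofStr, Pauli1.mul_self]

theorem ofStr_toMat_mul_self (s : Fin n → Pauli1) : (ofStr s).toMat * (ofStr s).toMat = 1 := by
  rw [← toMat_mul, ofStr_mul_self]
  exact toMat_one

theorem ofStr_toMat_conjTranspose (s : Fin n → Pauli1) :
    (ofStr s).toMatᴴ = (ofStr s).toMat := by
  ext a b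
  rw [Matrix.conjTranspose_apply, toMat_apply, toMat_apply]
  simp only [ofStr, ZMod.val_zero, pow_zero, one_mul, star_prod]
  refine Finset.prod_congr rfl fun j _ => ?_
  rw [← Matrix.conjTranspose_apply, Pauli1.toMat_conjTranspose]

theorem ofStr_toMat_ne_zero (s : Fin n → Pauli1) : (ofStr s).toMat ≠ 0 := by
  intro h
  have := ofStr_toMat_mul_self s
  rw [h, mul_zero] at this
  exact zero_ne_one this

theorem toMat_eq_smul_ofStr (P : Pauli n) :
    P.toMat = Complex.I ^ P.phase.val • (ofStr P.str).toMat := by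
  rw [← toMat_scale, ← eq_scale_ofStr]

theorem toMat_ne_zero (P : Pauli n) : P.toMat ≠ 0 := by
  rw [toMat_eq_smul_ofStr]
  exact smul_ne_zero (pow_ne_zero _ Complex.I_ne_zero) (ofStr_toMat_ne_zero _)

theorem herm_iff (P : Pauli n) : P.Herm ↔ P.toMatᴴ = P.toMat := by
  have hne := ofStr_toMat_ne_zero P.str
  rw [toMat_eq_smul_ofStr, Matrix.conjTranspose_smul, ofStr_toMat_conjTranspose,
    (smul_left_injective ℂ hne).eq_iff, Herm]
  have h1 : (1 : ZMod 4).val = 1 := rfl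
  have hI : ¬ (-Complex.I = Complex.I) := fun h => by
    have := congrArg Complex.im h; norm_num at this
  have hk : ∀ k : ZMod 4, k = 0 ∨ k = 1 ∨ k = 2 ∨ k = 3 := by decide
  rcases hk P.phase with h | h | h | h <;> rw [h]
  · simp
  · simpa [h1, hI] using (by decide : ¬ ((1 : ZMod 4) = 0 ∨ (1 : ZMod 4) = 2))
  · simp [zmod_four_val_two]
  · have hI' : ¬ (Complex.I = -Complex.I) := fun h => hI h.symm
    simpa [zmod_four_val_three, Complex.I_pow_three, hI'] using
      (by decide : ¬ ((3 : ZMod 4) = 0 ∨ (3 : ZMod 4) = 2))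

theorem toMat_mul_self {P : Pauli n} (h : P.Herm) : P.toMat * P.toMat = 1 := by
  rw [toMat_eq_smul_ofStr, smul_mul_smul_comm, ofStr_toMat_mul_self]
  rcases h with h | h <;> simp [h, zmod_four_val_two]

theorem lam_eq_of_comm {P Q P' Q' : Pauli n}
    (h : P'.toMat * Q'.toMat = (-1 : ℂ) ^ lam P Q • (Q'.toMat * P'.toMat)) :
    lam P' Q' = lam P Q := by
  rw [toMat_mul_toMat_comm, ← toMat_mul] at h
  have h' := smul_left_injective ℂ (toMat_ne_zero (Q' * P')) h
  have h1 := lam_lt_two P Q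
  have h2 := lam_lt_two P' Q'
  interval_cases lam P Q <;> interval_cases lam P' Q' <;>
    first | rfl | (exfalso; norm_num at h')

theorem toMat_hprod (P Q : Pauli n) :
    (hprod P Q).toMat = Complex.I ^ (3 * (lam P Q : ZMod 4)).val • (P.toMat * Q.toMat) := by
  rw [hprod, toMat_scale, toMat_mul]

theorem trace_ofStr_toMat (s : Fin n → Pauli1) (hs : s ≠ fun _ => .I) :
    (ofStr s).toMat.trace = 0 := by
  obtain ⟨j, hj⟩ := Function.ne_iff.mp hs
  have : (ofStr s).toMat.trace = ∏ j, (s j).toMat.trace := by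
    simp only [Matrix.trace, Matrix.diag_apply, toMat_apply, Finset.prod_univ_sum,
      Fintype.piFinset_univ]
    simp [ofStr]
  rw [this]
  exact Finset.prod_eq_zero (Finset.mem_univ j) (Pauli1.trace_toMat _ hj)

/-- Averaging a matrix over all Paulis replaces it by its trace. -/
theorem sum_ofStr_conj (M : Op n) :
    ∑ s : Fin n → Pauli1, (ofStr s).toMat * M * (ofStr s).toMat = ((2 : ℂ) ^ n * M.trace) • 1 := by
  ext i j
  have key : ∀ a b : Fin n → Fin 2,
      ∑ s : Fin n → Pauli1, (ofStr s).toMat i a * (ofStr s).toMat b j =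
        if a = b ∧ i = j then 2 ^ n else 0 := by
    intro a b
    have h : ∑ s : Fin n → Pauli1, (ofStr s).toMat i a * (ofStr s).toMat b j =
        ∏ k, ∑ p : Pauli1, p.toMat (i k) (a k) * p.toMat (b k) (j k) := by
      rw [Finset.prod_univ_sum, Fintype.piFinset_univ]
      simp [toMat_apply, ofStr, Finset.prod_mul_distrib]
    rw [h]
    simp only [Pauli1.sum_toMat_mul_toMat]
    split_ifs with hab
    · obtain ⟨rfl, rfl⟩ := hab; simp
    · have : ∃ k, ¬ (a k = b k ∧ i k = j k) := by
        by_contra hk; push Not at hk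
        exact hab ⟨funext fun k => (hk k).1, funext fun k => (hk k).2⟩
      obtain ⟨k, hk⟩ := this
      exact Finset.prod_eq_zero (Finset.mem_univ k) (if_neg hk)
  simp only [Matrix.sum_apply, Matrix.mul_apply, Finset.sum_mul]
  rw [Finset.sum_comm]
  calc _ = ∑ b, ∑ a, M a b *
        ∑ s : Fin n → Pauli1, (ofStr s).toMat i a * (ofStr s).toMat b j := by
        refine Finset.sum_congr rfl fun b _ => ?_
        rw [Finset.sum_comm]
        refine Finset.sum_congr rfl fun a _ => ?_
        rw [Finset.mul_sum]
        exact Finset.sum_congr rfl fun s _ => by ring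
    _ = _ := by
        simp only [key]
        by_cases hij : i = j
        · simp [hij, Matrix.trace, Finset.mul_sum, mul_comm]
        · simp [hij]

/-- Schur's lemma for the Paulis. -/
theorem eq_smul_one_of_commute (M : Op n) (h : ∀ s : Fin n → Pauli1, Commute (ofStr s).toMat M) :
    ∃ c : ℂ, M = c • 1 := by
  have h1 := sum_ofStr_conj M
  have h2 : ∀ s : Fin n → Pauli1, (ofStr s).toMat * M * (ofStr s).toMat = M := fun s => by
    rw [(h s).eq, mul_assoc, ofStr_toMat_mul_self, mul_one]
  simp only [h2, Finset.sum_const] at h1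
  set N := (Finset.univ : Finset (Fin n → Pauli1)).card with hN
  have hN0 : (N : ℂ) ≠ 0 := by
    have : 0 < N := Finset.card_pos.mpr ⟨fun _ => .I, Finset.mem_univ _⟩
    exact_mod_cast this.ne'
  refine ⟨(N : ℂ)⁻¹ * (2 ^ n * M.trace), ?_⟩
  rw [mul_smul, ← h1, ← Nat.cast_smul_eq_nsmul ℂ, smul_smul, inv_mul_cancel₀ hN0, one_smul]

theorem single_mul_ofStr (j : Fin n) (p : Pauli1) (s : Fin n → Pauli1) (hs : s j = .I) :
    single j p * ofStr s = ofStr (Function.update s j p) := by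
  ext k
  · have : ∀ k, (((single j p).str k).mul ((ofStr s).str k)).1 = 0 := by
      intro k
      by_cases hk : k = j
      · subst hk; simp [ofStr, hs, Pauli1.mul_I]
      · simp [single, hk, Pauli1.I_mul]
    simp only [mul_phase, this]
    simp [single, ofStr]
  · by_cases hk : k = j
    · subst hk; simp [ofStr, hs, Pauli1.mul_I, single]
    · simp [single, hk, Pauli1.I_mul, ofStr]

/-- A Pauli string is the product of its letters. -/
theorem prod_single (s : Fin n → Pauli1) :
    (List.ofFn fun j => single j (s j)).prod = ofStr s := by
  have : ∀ l : List (Fin n), l.Nodup →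
      (l.map fun j => single j (s j)).prod = ofStr fun j => if j ∈ l then s j else .I := by
    intro l hl
    induction l with
    | nil => simp; rfl
    | cons j l ih =>
      rw [List.nodup_cons] at hl
      rw [List.map_cons, List.prod_cons, ih hl.2, single_mul_ofStr _ _ _ (by simp [hl.1])]
      congr 1
      funext k
      by_cases hk : k = j
      · subst hk; simp
      · simp [hk]
  have h := this (List.finRange n) (List.nodup_finRange n)
  rw [← List.ofFn_eq_map] at h
  rw [h]; simp

end Pauli

/-! ### Pauli frames and their unitaries -/

theorem list_prod_ofFn_mul {M : Type*} [Monoid M] {n : ℕ} (f g : Fin n → M)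
    (h : ∀ i j, i ≠ j → Commute (f i) (g j)) :
    (List.ofFn fun j => f j * g j).prod = (List.ofFn f).prod * (List.ofFn g).prod := by
  induction n with
  | zero => simp
  | succ n ih =>
    simp only [List.ofFn_succ, List.prod_cons]
    rw [ih (fun j => f j.succ) (fun j => g j.succ)
      fun i j hij => h _ _ fun e => hij (Fin.succ_injective _ e)]
    have hc : Commute (List.ofFn fun j : Fin n => f j.succ).prod (g 0) := by
      refine Commute.list_prod_left _ _ fun x hx => ?_
      obtain ⟨j, rfl⟩ := (List.mem_ofFn' _ _).mp hx
      exact h _ _ (Fin.succ_ne_zero j)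
    rw [mul_assoc, ← mul_assoc (g 0), ← hc.eq]
    simp only [mul_assoc]

theorem list_prod_ofFn_smul {R A : Type*} [CommRing R] [Ring A] [Algebra R A] {n : ℕ}
    (c : Fin n → R) (f : Fin n → A) :
    (List.ofFn fun j => c j • f j).prod = (∏ j, c j) • (List.ofFn f).prod := by
  induction n with
  | zero => simp
  | succ n ih =>
    simp only [List.ofFn_succ, List.prod_cons, Fin.prod_univ_succ]
    rw [ih (fun j => c j.succ) (fun j => f j.succ), smul_mul_smul_comm]

theorem list_prod_ofFn_ite_eq {M : Type*} [Monoid M] {n : ℕ} (j : Fin n) (a : M) :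
    (List.ofFn fun k => if k = j then a else 1).prod = a := by
  have h : ∀ l : List (Fin n), l.Nodup →
      (l.map fun k => if k = j then a else 1).prod = if j ∈ l then a else 1 := by
    intro l hl
    induction l with
    | nil => simp
    | cons k l ih =>
      rw [List.nodup_cons] at hl
      rw [List.map_cons, List.prod_cons, ih hl.2]
      by_cases hk : k = j
      · subst hk; simp [hl.1]
      · simp [hk, Ne.symm hk]
  have := h (List.finRange n) (List.nodup_finRange n)
  rw [← List.ofFn_eq_map] at this
  simpa using this

theorem conj_list_prod {m : Type*} [Fintype m] [DecidableEq m] {U : Matrix m m ℂ}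
    (hU : U ∈ Matrix.unitaryGroup m ℂ) (l : List (Matrix m m ℂ)) :
    Uᴴ * l.prod * U = (l.map fun A => Uᴴ * A * U).prod := by
  have h1 : Uᴴ * U = 1 := Matrix.mem_unitaryGroup_iff'.mp hU
  have h2 : U * Uᴴ = 1 := Matrix.mem_unitaryGroup_iff.mp hU
  induction l with
  | nil => simp [h1]
  | cons A l ih =>
    rw [List.map_cons, List.prod_cons, List.prod_cons, ← ih]
    calc _ = Uᴴ * A * 1 * l.prod * U := by simp only [mul_one, mul_assoc]
      _ = _ := by rw [← h2]; simp only [mul_assoc]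

theorem Pauli.herm_of_toMat_mul_self {n : ℕ} {P : Pauli n} (h : P.toMat * P.toMat = 1) :
    P.Herm := by
  rw [toMat_eq_smul_ofStr, smul_mul_smul_comm, ofStr_toMat_mul_self] at h
  have h' : Complex.I ^ P.phase.val * Complex.I ^ P.phase.val = 1 := by
    have := congrFun (congrFun h fun _ => 0) fun _ => 0
    simpa using this
  have h1 : (1 : ZMod 4).val = 1 := rfl
  have hk : ∀ k : ZMod 4, k = 0 ∨ k = 1 ∨ k = 2 ∨ k = 3 := by decide
  rcases hk P.phase with h | h | h | h
  · exact Or.inl h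
  · rw [h] at h'; norm_num [h1] at h'
  · exact Or.inr h
  · rw [h] at h'; norm_num [zmod_four_val_three, Complex.I_pow_three] at h'

namespace Frame

variable {n : ℕ}

theorem toMat_act (F : Frame n) (P : Pauli n) : (F.act P).toMat =
    Complex.I ^ P.phase.val • (List.ofFn fun j => (F.eff j (P.str j)).toMat).prod := by
  rw [act, Pauli.toMat_scale, Pauli.toMat_list_prod, List.map_ofFn]
  rfl

theorem toMat_act_scale (F : Frame n) (k : ZMod 4) (P : Pauli n) :
    (F.act (Pauli.scale k P)).toMat = Complex.I ^ k.val • (F.act P).toMat := by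
  rw [toMat_act, toMat_act, smul_smul, ← I_pow_val_add]; rfl

theorem toMat_act_ofStr_I (F : Frame n) : (F.act (Pauli.ofStr fun _ => .I)).toMat = 1 := by
  rw [toMat_act]
  simp [Pauli.ofStr, eff]

theorem toMat_eff_Y {F : Frame n} (hF : F.WF) (j : Fin n) :
    (F.eff j .Y).toMat = -(Complex.I • ((F.effZ j).toMat * (F.effX j).toMat)) := by
  have h : Pauli.lam (F.effZ j) (F.effX j) = 1 := by simpa using (hF.2 j j).2.2
  have h3 : (3 * ((1 : ℕ) : ZMod 4)).val = 3 := rfl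
  rw [eff, Pauli.toMat_hprod, h, h3, Complex.I_pow_three, neg_smul]

theorem toMat_eff_mul {F : Frame n} (hF : F.WF) (j : Fin n) (p q : Pauli1) :
    (F.eff j p).toMat * (F.eff j q).toMat =
      Complex.I ^ (p.mul q).1.val • (F.eff j (p.mul q).2).toMat := by
  have hz : (F.effZ j).toMat * (F.effZ j).toMat = 1 := Pauli.toMat_mul_self (hF.1 j).1
  have hx : (F.effX j).toMat * (F.effX j).toMat = 1 := Pauli.toMat_mul_self (hF.1 j).2
  have hzx : (F.effX j).toMat * (F.effZ j).toMat = -((F.effZ j).toMat * (F.effX j).toMat) := by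
    rw [Pauli.toMat_anticomm (P := F.effZ j) (by simpa using (hF.2 j j).2.2), neg_neg]
  have hY := toMat_eff_Y hF j
  have hX : (F.eff j .X).toMat = (F.effX j).toMat := rfl
  have hZ : (F.eff j .Z).toMat = (F.effZ j).toMat := rfl
  have hI : (F.eff j .I).toMat = 1 := Pauli.toMat_one
  generalize (F.effZ j).toMat = z at *
  generalize (F.effX j).toMat = x at *
  have h1 : ∀ a, z * (z * a) = a := fun a => by rw [← mul_assoc, hz, one_mul]
  have h3 : ∀ a, x * (z * a) = -(z * (x * a)) := fun a => by
    rw [← mul_assoc, hzx, neg_mul, mul_assoc]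
  have h4 : (1 : ZMod 4).val = 1 := rfl
  cases p <;> cases q <;>
    simp only [hX, hY, hZ, hI, Pauli1.mul, ZMod.val_zero, h4, zmod_four_val_three,
      Complex.I_pow_three, pow_zero, pow_one, one_smul, one_mul, mul_one, hz, hx, hzx, h1, h3,
      neg_mul, mul_neg, neg_neg, smul_mul_assoc, mul_smul_comm, smul_smul, mul_assoc, smul_neg,
      neg_smul, Complex.I_mul_I]

theorem commute_toMat_eff_right {F : Frame n} (hF : F.WF) {j : Fin n} {A : Op n}
    (hz : Commute A (F.effZ j).toMat) (hx : Commute A (F.effX j).toMat) (p : Pauli1) :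
    Commute A (F.eff j p).toMat := by
  cases p with
  | I => rw [eff, Pauli.toMat_one]; exact Commute.one_right A
  | X => exact hx
  | Y => rw [toMat_eff_Y hF]; exact ((hz.mul_right hx).smul_right _).neg_right
  | Z => exact hz

theorem commute_toMat_eff {F : Frame n} (hF : F.WF) {j k : Fin n} (hjk : j ≠ k) (p q : Pauli1) :
    Commute (F.eff j p).toMat (F.eff k q).toMat := by
  have hzx : Pauli.lam (F.effZ j) (F.effX k) = 0 := by simpa [hjk] using (hF.2 j k).2.2
  have hxz : Pauli.lam (F.effZ k) (F.effX j) = 0 := by simpa [hjk.symm] using (hF.2 k j).2.2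
  refine commute_toMat_eff_right hF ?_ ?_ q <;> refine (commute_toMat_eff_right hF ?_ ?_ p).symm
  · exact Pauli.commute_of_comm (hF.2 k j).1
  · exact Pauli.commute_of_comm hxz
  · exact (Pauli.commute_of_comm hzx).symm
  · exact Pauli.commute_of_comm (hF.2 k j).2.1

/-- The lookup action of a Pauli frame is multiplicative. -/
theorem toMat_act_mul {F : Frame n} (hF : F.WF) (P Q : Pauli n) :
    (F.act (P * Q)).toMat = (F.act P).toMat * (F.act Q).toMat := by
  simp only [toMat_act]
  rw [smul_mul_smul_comm, ← list_prod_ofFn_mul _ _ fun i j hij => commute_toMat_eff hF hij _ _]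
  simp only [toMat_eff_mul hF]
  rw [list_prod_ofFn_smul, smul_smul, ← I_pow_val_sum, ← I_pow_val_add, ← I_pow_val_add]
  rfl

open scoped ComplexOrder in
/-- Every Pauli frame has a unitary. The matrix `V = ∑ s, F(s) M s`, summed over the Paulis `s`,
satisfies `F(q) V = V q`, so that `Vᴴ V` commutes with all Paulis and is a scalar; some `M` gives a
nonzero `V`, and `Vᴴ` is then a multiple of the unitary. -/
theorem exists_isUnitaryOf {F : Frame n} (hF : F.WF) : ∃ U, F.IsUnitaryOf U := by
  set φ : (Fin n → Pauli1) → Op n := fun s => (F.act (Pauli.ofStr s)).toMat with hφ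
  have hφφ : ∀ s, φ s * φ s = 1 := by
    intro s
    rw [hφ, ← toMat_act_mul hF, Pauli.ofStr_mul_self, toMat_act_ofStr_I]
  have hφH : ∀ s, (φ s)ᴴ = φ s := fun s =>
    (Pauli.herm_iff _).mp (Pauli.herm_of_toMat_mul_self (hφφ s))
  have hmul : ∀ q s, ∃ k : ZMod 4, ∃ r, φ q * φ s = Complex.I ^ k.val • φ r ∧
      (Pauli.ofStr q).toMat * (Pauli.ofStr s).toMat = Complex.I ^ k.val • (Pauli.ofStr r).toMat ∧
      r = fun j => ((q j).mul (s j)).2 := by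
    intro q s
    refine ⟨(Pauli.ofStr q * Pauli.ofStr s).phase, (Pauli.ofStr q * Pauli.ofStr s).str,
      ?_, ?_, rfl⟩
    · rw [hφ, ← toMat_act_mul hF, ← toMat_act_scale, ← Pauli.eq_scale_ofStr]
    · rw [← Pauli.toMat_mul, ← Pauli.toMat_scale, ← Pauli.eq_scale_ofStr]
  set T : Op n → Op n := fun M => ∑ s, φ s * M * (Pauli.ofStr s).toMat with hT
  -- The terms of `F(q) V q` are those of `V`, permuted by multiplication by `q`.
  have hTq' : ∀ M q, φ q * T M * (Pauli.ofStr q).toMat = T M := by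
    intro M q
    rw [hT]
    simp only [Finset.mul_sum, Finset.sum_mul]
    refine Finset.sum_bij' (fun s _ j => ((q j).mul (s j)).2) (fun s _ j => ((q j).mul (s j)).2)
      (fun _ _ => Finset.mem_univ _) (fun _ _ => Finset.mem_univ _) ?_ ?_ ?_
    · intro s _; funext j; exact Pauli1.mul_mul_self_snd _ _
    · intro s _; funext j; exact Pauli1.mul_mul_self_snd _ _
    · intro s _
      obtain ⟨k, r, h1, h2, hr⟩ := hmul q s
      have h3 : (Pauli.ofStr s).toMat * (Pauli.ofStr q).toMat =
          star (Complex.I ^ k.val) • (Pauli.ofStr r).toMat := by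
        have := congrArg Matrix.conjTranspose h2
        simpa only [Matrix.conjTranspose_mul, Matrix.conjTranspose_smul,
          Pauli.ofStr_toMat_conjTranspose] using this
      have h4 : Complex.I ^ k.val * star (Complex.I ^ k.val) = 1 := by
        rw [star_pow, ← mul_pow]; simp
      rw [← hr]
      calc _ = (φ q * φ s) * M * ((Pauli.ofStr s).toMat * (Pauli.ofStr q).toMat) := by
            simp only [mul_assoc]
        _ = _ := by
            rw [h1, h3, smul_mul_assoc, smul_mul_smul_comm, h4, one_smul]
  have hTq : ∀ M q, φ q * T M = T M * (Pauli.ofStr q).toMat := by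
    intro M q
    conv_rhs => rw [← hTq' M q]
    rw [mul_assoc _ (Pauli.ofStr q).toMat, Pauli.ofStr_toMat_mul_self, mul_one]
  -- If `T` vanished on all matrix units, then so would `∑ s, F(s) (tr s)`, which is `2 ^ n` because
  -- only `s = 1` has a nonzero trace.
  obtain ⟨M, hM⟩ : ∃ M, T M ≠ 0 := by
    by_contra! hall
    let a : Fin n → Fin 2 := fun _ => 0
    have h1 : ∀ b, ∑ s, φ s a a * (Pauli.ofStr s).toMat b b = 0 := by
      intro b
      have := congrFun (congrFun (hall (Matrix.single a b 1)) a) b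
      rw [hT] at this
      simpa [Matrix.sum_apply, Matrix.mul_apply, Matrix.single_apply, ite_and] using this
    have h2 : ∑ s, φ s a a * (Pauli.ofStr s).toMat.trace = 0 := by
      simp only [Matrix.trace, Matrix.diag_apply, Finset.mul_sum]
      rw [Finset.sum_comm]
      exact Finset.sum_eq_zero fun b _ => h1 b
    rw [Finset.sum_eq_single (fun _ => Pauli1.I)] at h2
    · have hI : (Pauli.ofStr fun _ : Fin n => Pauli1.I) = 1 := rfl
      simp only [hφ, toMat_act_ofStr_I] at h2
      simp only [hI, Pauli.toMat_one, Matrix.trace_one] at h2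
      simp at h2
    · intro s _ hs
      rw [Pauli.trace_ofStr_toMat s hs, mul_zero]
    · simp
  set V := T M with hV
  obtain ⟨c, hc⟩ := Pauli.eq_smul_one_of_commute (Vᴴ * V) fun s => by
    have h1 := hTq M s
    have h2 := congrArg Matrix.conjTranspose h1
    simp only [Matrix.conjTranspose_mul, hφH, Pauli.ofStr_toMat_conjTranspose] at h2
    change (Pauli.ofStr s).toMat * (Vᴴ * V) = Vᴴ * V * (Pauli.ofStr s).toMat
    rw [← mul_assoc, ← h2, mul_assoc, h1, mul_assoc]
  have hc0 : c ≠ 0 := by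
    rintro rfl
    rw [zero_smul] at hc
    exact hM (Matrix.conjTranspose_mul_self_eq_zero.mp hc)
  -- A diagonal entry of `Vᴴ V` is a sum of squares, so `c` is positive and has a square root.
  obtain ⟨r, hr0, hr⟩ : ∃ r : ℝ, 0 < r ∧ c = (r * r : ℝ) := by
    have h1 : c = (∑ k, Complex.normSq (V k fun _ => 0) : ℝ) := by
      have := congrFun (congrFun hc fun _ => 0) fun _ => 0
      simp only [Matrix.mul_apply, Matrix.conjTranspose_apply, Matrix.smul_apply,
        Matrix.one_apply_eq, smul_eq_mul, mul_one] at this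
      rw [← this]
      push_cast
      refine Finset.sum_congr rfl fun k _ => ?_
      rw [Complex.normSq_eq_conj_mul_self]; rfl
    set t := ∑ k, Complex.normSq (V k fun _ => 0)
    have ht : 0 ≤ t := Finset.sum_nonneg fun k _ => Complex.normSq_nonneg _
    have ht' : t ≠ 0 := by
      intro h; rw [h] at h1; exact hc0 (by simpa using h1)
    refine ⟨√t, Real.sqrt_pos.mpr (lt_of_le_of_ne ht ht'.symm), ?_⟩
    rw [Real.mul_self_sqrt ht, h1]
  have hrC : (r : ℂ) ≠ 0 := by exact_mod_cast hr0.ne'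
  set W : Op n := ((r : ℂ)⁻¹) • V with hW
  have hWW : Wᴴ * W = 1 := by
    rw [hW, Matrix.conjTranspose_smul, smul_mul_smul_comm, hc, hr, smul_smul]
    have : star ((r : ℂ)⁻¹) = (r : ℂ)⁻¹ := by simp [← Complex.ofReal_inv]
    rw [this]; push_cast
    rw [show (r : ℂ)⁻¹ * (r : ℂ)⁻¹ * (r * r) = 1 by field_simp, one_smul]
  have hWW' : W * Wᴴ = 1 := mul_eq_one_comm.mp hWW
  refine ⟨Wᴴ, ?_, fun P => ?_⟩
  · rw [Matrix.mem_unitaryGroup_iff, Matrix.star_eq_conjTranspose,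
      Matrix.conjTranspose_conjTranspose]
    exact hWW
  · have h1 : φ P.str * W = W * (Pauli.ofStr P.str).toMat := by
      rw [hW, mul_smul_comm, hTq M, smul_mul_assoc]
    rw [Pauli.eq_scale_ofStr P, toMat_act_scale, Pauli.toMat_scale,
      Matrix.conjTranspose_conjTranspose, mul_smul_comm, smul_mul_assoc]
    change _ • φ P.str = _
    rw [← h1, mul_assoc, hWW', mul_one]

theorem isUnitaryOf_unitary {F : Frame n} (hF : F.WF) : F.IsUnitaryOf F.unitary :=
  Classical.epsilon_spec (exists_isUnitaryOf hF)

theorem IsUnitaryOf.conjTranspose_mul_self {F : Frame n} {U : Op n} (h : F.IsUnitaryOf U) :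
    Uᴴ * U = 1 := Matrix.mem_unitaryGroup_iff'.mp h.1

theorem IsUnitaryOf.mul_conjTranspose_self {F : Frame n} {U : Op n} (h : F.IsUnitaryOf U) :
    U * Uᴴ = 1 := Matrix.mem_unitaryGroup_iff.mp h.1

/-- The unitary of a frame is unique up to a phase, which conjugation does not see. -/
theorem IsUnitaryOf.conj_eq {F : Frame n} {U V : Op n} (hU : F.IsUnitaryOf U)
    (hV : F.IsUnitaryOf V) (ρ : Op n) : U * ρ * Uᴴ = V * ρ * Vᴴ := by
  obtain ⟨c, hc⟩ := Pauli.eq_smul_one_of_commute (U * Vᴴ) fun s => by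
    have h := (hU.2 (Pauli.ofStr s)).symm.trans (hV.2 (Pauli.ofStr s))
    have h1 := congrArg (fun A => U * A * Vᴴ) h
    simp only [← mul_assoc, hU.mul_conjTranspose_self, one_mul] at h1
    rw [mul_assoc _ V, hV.mul_conjTranspose_self, mul_one, mul_assoc] at h1
    exact h1
  have hUV : U = c • V := by
    have := congrArg (· * V) hc
    simpa [mul_assoc, hV.conjTranspose_mul_self] using this
  have hcc : c * star c = 1 := by
    have := hU.mul_conjTranspose_self
    rw [hUV, Matrix.conjTranspose_smul, smul_mul_smul_comm, hV.mul_conjTranspose_self] at this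
    simpa using congrFun (congrFun this fun _ => 0) fun _ => 0
  rw [hUV, Matrix.conjTranspose_smul, smul_mul_assoc, smul_mul_smul_comm, hcc, one_smul]

theorem toMat_eq_prod_single (P : Pauli n) : P.toMat =
    Complex.I ^ P.phase.val • (List.ofFn fun j => (Pauli.single j (P.str j)).toMat).prod := by
  rw [Pauli.toMat_eq_smul_ofStr, ← Pauli.prod_single, Pauli.toMat_list_prod, List.map_ofFn]
  rfl

theorem single_herm (j : Fin n) (p : Pauli1) : (Pauli.single j p).Herm := Or.inl rfl

theorem lam_single (i j : Fin n) (p q : Pauli1) :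
    Pauli.lam (Pauli.single i p) (Pauli.single j q) = if i = j then p.lam q else 0 := by
  have hlt : ∀ p q : Pauli1, p.lam q < 2 := fun p q => by
    unfold Pauli1.lam; split_ifs <;> norm_num
  have hI : ∀ p, Pauli1.lam .I p = 0 := fun p => by cases p <;> rfl
  have hI' : ∀ p, Pauli1.lam p .I = 0 := fun p => by cases p <;> rfl
  unfold Pauli.lam
  rw [Finset.sum_eq_single i]
  · split_ifs with h
    · subst h; simp [Pauli.single, Nat.mod_eq_of_lt (hlt p q)]
    · simp [Pauli.single, h, hI']
  · intro k _ hk; simp [Pauli.single, hk, hI]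
  · simp

theorem origin_wf : (origin : Frame n).WF :=
  ⟨fun _ => ⟨single_herm _ _, single_herm _ _⟩, fun _ _ =>
    ⟨by rw [origin, lam_single]; simp [Pauli1.lam], by rw [origin, lam_single]; simp [Pauli1.lam],
      by rw [origin, lam_single]; rfl⟩⟩

theorem toMat_single_Y (j : Fin n) : (Pauli.single j .Y).toMat =
    -(Complex.I • ((Pauli.single j .Z).toMat * (Pauli.single j .X).toMat)) := by
  have h : (Pauli.single j .Z * Pauli.single j .X : Pauli n) =
      Pauli.scale 1 (Pauli.single j .Y) := by
    ext k
    · rw [Pauli.mul_phase, Finset.sum_eq_single j]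
      · simp [Pauli.single, Pauli.scale, Pauli1.mul]
      · intro k _ hk; simp [Pauli.single, hk, Pauli1.mul]
      · simp
    · by_cases hk : k = j
      · subst hk; simp [Pauli.single, Pauli.scale, Pauli1.mul]
      · simp [Pauli.single, Pauli.scale, hk, Pauli1.mul]
  have h1 : (1 : ZMod 4).val = 1 := rfl
  rw [← Pauli.toMat_mul, h, Pauli.toMat_scale, h1, pow_one, smul_smul, Complex.I_mul_I, neg_smul,
    one_smul, neg_neg]

/-- A frame whose entries are `Uᴴ Z_j U` and `Uᴴ X_j U` is well-formed. -/
theorem IsFrameOf.wf {F : Frame n} {U : Op n} (h : F.IsFrameOf U)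
    (hU : U ∈ Matrix.unitaryGroup (Fin n → Fin 2) ℂ) : F.WF := by
  have h2 : U * Uᴴ = 1 := Matrix.mem_unitaryGroup_iff.mp hU
  have herm : ∀ P Q : Pauli n, Q.Herm → P.toMat = Uᴴ * Q.toMat * U → P.Herm := by
    intro P Q hQ hP
    rw [Pauli.herm_iff] at hQ ⊢
    rw [hP]
    simp only [Matrix.conjTranspose_mul, Matrix.conjTranspose_conjTranspose, hQ, mul_assoc]
  have hl : ∀ P P' Q Q' : Pauli n, P'.toMat = Uᴴ * P.toMat * U → Q'.toMat = Uᴴ * Q.toMat * U →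
      Pauli.lam P' Q' = Pauli.lam P Q := by
    intro P P' Q Q' hP hQ
    have hm : ∀ A B : Op n, Uᴴ * A * U * (Uᴴ * B * U) = Uᴴ * (A * B) * U := fun A B => by
      calc _ = Uᴴ * A * (U * Uᴴ) * B * U := by simp only [mul_assoc]
        _ = _ := by rw [h2]; simp only [mul_one, mul_assoc]
    refine Pauli.lam_eq_of_comm ?_
    rw [hP, hQ, hm, hm, Pauli.toMat_mul_toMat_comm, mul_smul_comm, smul_mul_assoc]
  have ho := origin_wf (n := n)
  refine ⟨fun j => ⟨herm _ _ (single_herm j .Z) (h j).1, herm _ _ (single_herm j .X) (h j).2⟩,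
    fun i j => ⟨?_, ?_, ?_⟩⟩
  · rw [hl _ _ _ _ (h i).1 (h j).1]; exact (ho.2 i j).1
  · rw [hl _ _ _ _ (h i).2 (h j).2]; exact (ho.2 i j).2.1
  · rw [hl _ _ _ _ (h i).1 (h j).2]; exact (ho.2 i j).2.2

/-- A frame that agrees with conjugation by a unitary on the `Z_j` and `X_j` does so on all
Paulis. -/
theorem IsFrameOf.isUnitaryOf {F : Frame n} {U : Op n} (h : F.IsFrameOf U)
    (hU : U ∈ Matrix.unitaryGroup (Fin n → Fin 2) ℂ) : F.IsUnitaryOf U := by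
  have h1 : Uᴴ * U = 1 := Matrix.mem_unitaryGroup_iff'.mp hU
  have h2 : U * Uᴴ = 1 := Matrix.mem_unitaryGroup_iff.mp hU
  have hF := h.wf hU
  have hs : ∀ j p, (F.eff j p).toMat = Uᴴ * (Pauli.single j p).toMat * U := by
    intro j p
    cases p with
    | I =>
      have : (Pauli.single j .I : Pauli n) = 1 := by
        unfold Pauli.single; rw [Function.update_eq_self_iff.mpr rfl]; rfl
      rw [this, Pauli.toMat_one, mul_one, h1]; exact Pauli.toMat_one
    | X => exact (h j).2
    | Z => exact (h j).1
    | Y =>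
      rw [toMat_eff_Y hF, toMat_single_Y, (h j).1, (h j).2, mul_neg, neg_mul, mul_smul_comm,
        smul_mul_assoc]
      congr 2
      calc _ = Uᴴ * (Pauli.single j .Z).toMat * (U * Uᴴ) * (Pauli.single j .X).toMat * U := by
            simp only [mul_assoc]
        _ = _ := by rw [h2]; simp only [mul_one, mul_assoc]
  refine ⟨hU, fun P => ?_⟩
  rw [toMat_act, toMat_eq_prod_single, mul_smul_comm, smul_mul_assoc, conj_list_prod hU,
    List.map_ofFn]
  simp only [hs]
  rfl

theorem origin_isUnitaryOf : (origin : Frame n).IsUnitaryOf 1 :=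
  IsFrameOf.isUnitaryOf (fun j => by simp [origin]) (one_mem _)

theorem IsUnitaryOf.lam_act {F : Frame n} {U : Op n} (h : F.IsUnitaryOf U) (P Q : Pauli n) :
    Pauli.lam (F.act P) (F.act Q) = Pauli.lam P Q := by
  have h2 := h.mul_conjTranspose_self
  have hm : ∀ A B : Op n, Uᴴ * A * U * (Uᴴ * B * U) = Uᴴ * (A * B) * U := fun A B => by
    calc _ = Uᴴ * A * (U * Uᴴ) * B * U := by simp only [mul_assoc]
      _ = _ := by rw [h2]; simp only [mul_one, mul_assoc]
  refine Pauli.lam_eq_of_comm ?_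
  rw [h.2, h.2, hm, hm, Pauli.toMat_mul_toMat_comm, mul_smul_comm, smul_mul_assoc]

theorem IsUnitaryOf.herm_act {F : Frame n} {U : Op n} (h : F.IsUnitaryOf U) {P : Pauli n}
    (hP : P.Herm) : (F.act P).Herm := by
  rw [Pauli.herm_iff] at hP ⊢
  rw [h.2]
  simp only [Matrix.conjTranspose_mul, Matrix.conjTranspose_conjTranspose, hP, mul_assoc]

theorem comp_wf {F₁ F₂ : Frame n} (h₁ : F₁.WF) (h₂ : F₂.WF) : (F₂.comp F₁).WF := by
  have h := isUnitaryOf_unitary h₁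
  refine ⟨fun j => ⟨h.herm_act (h₂.1 j).1, h.herm_act (h₂.1 j).2⟩, fun i j => ?_⟩
  have := h₂.2 i j
  simpa only [comp, h.lam_act] using this

theorem toMat_act_single (F : Frame n) (j : Fin n) (p : Pauli1) :
    (F.act (Pauli.single j p)).toMat = (F.eff j p).toMat := by
  have h : ∀ k, (F.eff k ((Pauli.single j p).str k)).toMat =
      if k = j then (F.eff j p).toMat else 1 := by
    intro k
    split_ifs with hk
    · subst hk; simp [Pauli.single]
    · simp [Pauli.single, hk, eff]
  have h0 : (Pauli.single j p).phase.val = 0 := rfl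
  rw [toMat_act, h0, pow_zero, one_smul]
  simp only [h]
  exact list_prod_ofFn_ite_eq j _

theorem comp_isUnitaryOf {F₁ F₂ : Frame n} {U₁ U₂ : Op n}
    (hU₁ : F₁.IsUnitaryOf U₁) (hU₂ : F₂.IsUnitaryOf U₂) :
    (F₂.comp F₁).IsUnitaryOf (U₂ * U₁) := by
  refine IsFrameOf.isUnitaryOf (fun j => ?_) (mul_mem hU₂.1 hU₁.1)
  have hc : ∀ A : Op n, (U₂ * U₁)ᴴ * A * (U₂ * U₁) = U₁ᴴ * (U₂ᴴ * A * U₂) * U₁ := fun A => by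
    simp only [Matrix.conjTranspose_mul, mul_assoc]
  rw [hc, hc, ← hU₂.2, ← hU₂.2, toMat_act_single F₂, toMat_act_single F₂, comp]
  exact ⟨hU₁.2 _, hU₁.2 _⟩

end Frame

/-! ### Channels of nodes -/

section Channels

variable {n : ℕ} {κ κ' : Type*}

/-- Relabelling by a measurement space function, as an additive map. -/
def muHom (f : ClState κ → ClState κ') : CQ n κ →+ CQ n κ' :=
  Finsupp.mapDomain.addMonoidHom f

@[simp] theorem muHom_single (f : ClState κ → ClState κ') (m : ClState κ) (ρ : Op n) :
    muHom f (Finsupp.single m ρ) = Finsupp.single (f m) ρ := Finsupp.mapDomain_single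

theorem muChan_comp {κ'' : Type*} (g : ClState κ' → ClState κ'') (f : ClState κ → ClState κ')
    (γ : CQ n κ) : muChan (g ∘ f) γ = muChan g (muChan f γ) := Finsupp.mapDomain_comp

theorem muChan_id (γ : CQ n κ) : muChan id γ = γ := Finsupp.mapDomain_id

/-- Additive maps on cq-states are determined by their values on one classical state. -/
theorem cq_hom_ext {f g : CQ n κ →+ CQ n κ'}
    (h : ∀ m ρ, f (Finsupp.single m ρ) = g (Finsupp.single m ρ)) (γ : CQ n κ) : f γ = g γ :=
  DFunLike.congr_fun (Finsupp.addHom_ext h) γ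

variable [DecidableEq κ]

/-- The channel of a node, as an additive map. -/
def Node.semHom (nd : Node n κ) : CQ n κ →+ CQ n κ where
  toFun := nd.sem
  map_zero' := by cases nd <;> simp [Node.sem, muChan]
  map_add' γ δ := by
    cases nd with
    | rot P θ =>
      exact Finsupp.mapRange_add (hf := by simp) (fun a b => by simp only [mul_add, add_mul]) γ δ
    | prep PZ PX =>
      refine Finsupp.mapRange_add (hf := by simp) (fun a b => ?_) γ δ
      simp only [mul_add, add_mul, smul_add]; abel
    | meas c P =>
      simp only [Node.sem]
      refine Finsupp.sum_add_index' (fun m => by simp) fun m a b => ?_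
      simp only [mul_add, add_mul, smul_add, Finsupp.single_add]; abel
    | frame F =>
      exact Finsupp.mapRange_add (hf := by simp) (fun a b => by simp only [mul_add, add_mul]) γ δ
    | mu μ => exact Finsupp.mapDomain_add

theorem Node.semHom_apply (nd : Node n κ) (γ : CQ n κ) : nd.semHom γ = nd.sem γ := rfl

theorem semHom_rot_single (P : Pauli n) (θ : ℝ) (m : ClState κ) (ρ : Op n) :
    (Node.rot P θ).semHom (Finsupp.single m ρ) =
      Finsupp.single m (rotMat P θ * ρ * rotMat P (-θ)) :=
  Finsupp.mapRange_single (hf := by simp)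

theorem semHom_prep_single (PZ PX : Pauli n) (m : ClState κ) (ρ : Op n) :
    (Node.prep PZ PX).semHom (Finsupp.single m ρ) = Finsupp.single m ((1 / 4 : ℂ) •
      ((1 + PZ.toMat) * ρ * (1 + PZ.toMat) +
        PX.toMat * (1 - PZ.toMat) * ρ * (1 - PZ.toMat) * PX.toMat)) :=
  Finsupp.mapRange_single (hf := by simp)

theorem semHom_meas_single (c : κ) (P : Pauli n) (m : ClState κ) (ρ : Op n) :
    (Node.meas c P).semHom (Finsupp.single m ρ) =
      Finsupp.single (assign m c (some false))
        ((1 / 4 : ℂ) • ((1 + P.toMat) * ρ * (1 + P.toMat))) +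
      Finsupp.single (assign m c (some true))
        ((1 / 4 : ℂ) • ((1 - P.toMat) * ρ * (1 - P.toMat))) := by
  simp only [Node.semHom_apply, Node.sem]
  exact Finsupp.sum_single_index (by simp)

theorem semHom_frame_single (F : Frame n) (m : ClState κ) (ρ : Op n) :
    (Node.frame F).semHom (Finsupp.single m ρ) =
      Finsupp.single m (F.unitary * ρ * F.unitaryᴴ) :=
  Finsupp.mapRange_single (hf := by simp)

theorem termSem_append (t s : Term n κ) (γ : CQ n κ) :
    termSem (t ++ s) γ = termSem s (termSem t γ) := List.foldl_append

theorem termSem_cons (nd : Node n κ) (t : Term n κ) (γ : CQ n κ) :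
    termSem (nd :: t) γ = termSem t (nd.sem γ) := rfl

theorem termSem_singleton (nd : Node n κ) (γ : CQ n κ) : termSem [nd] γ = nd.sem γ := rfl

/-! ### Commuting nodes -/

/-- The elementary channel `ρ ↦ A ρ B` that relabels the classical state by `f`. -/
def atom (f : MFun κ) (A B : Op n) : CQ n κ →+ CQ n κ :=
  Finsupp.liftAddHom fun m => (Finsupp.singleAddHom (f m)).comp
    ((AddMonoidHom.mulRight B).comp (AddMonoidHom.mulLeft A))

omit [DecidableEq κ] in
theorem atom_single (f : MFun κ) (A B : Op n) (m : ClState κ) (ρ : Op n) :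
    atom f A B (Finsupp.single m ρ) = Finsupp.single (f m) (A * ρ * B) :=
  Finsupp.liftAddHom_apply_single _ _ _

omit [DecidableEq κ] in
theorem atom_comm {f g : MFun κ} {A B C D : Op n} (hfg : f ∘ g = g ∘ f)
    (hAC : Commute A C) (hBD : Commute B D) (γ : CQ n κ) :
    atom f A B (atom g C D γ) = atom g C D (atom f A B γ) := by
  refine cq_hom_ext (f := (atom f A B).comp (atom g C D)) (g := (atom g C D).comp (atom f A B))
    (fun m ρ => ?_) γ
  simp only [AddMonoidHom.comp_apply, atom_single]
  have h1 : f (g m) = g (f m) := congrFun hfg m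
  rw [h1]
  congr 1
  calc _ = (A * C) * ρ * (D * B) := by simp only [mul_assoc]
    _ = _ := by rw [hAC.eq, ← hBD.eq]; simp only [mul_assoc]

namespace Node

/-- The classical variable written by a measurement. -/
def mvar : Node n κ → Option κ
  | .meas c _ => some c
  | _ => none

/-- The Pauli arguments of a node. -/
def paulis : Node n κ → List (Pauli n)
  | .rot P _ => [P]
  | .prep PZ PX => [PZ, PX]
  | .meas _ P => [P]
  | _ => []

/-- The Kraus form of the channel of a rotation, preparation or measurement: the channel is the sum
of the channels `atom f A B` over the triples `(f, A, B)` in this list. -/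
def kraus : Node n κ → List (MFun κ × Op n × Op n)
  | .rot P θ => [(id, rotMat P θ, rotMat P (-θ))]
  | .prep PZ PX => [(id, (1 / 4 : ℂ) • (1 + PZ.toMat), 1 + PZ.toMat),
      (id, (1 / 4 : ℂ) • (PX.toMat * (1 - PZ.toMat)), (1 - PZ.toMat) * PX.toMat)]
  | .meas c P => [(fun m => assign m c (some false), (1 / 4 : ℂ) • (1 + P.toMat), 1 + P.toMat),
      (fun m => assign m c (some true), (1 / 4 : ℂ) • (1 - P.toMat), 1 - P.toMat)]
  | _ => []

theorem sem_eq_kraus {nd : Node n κ} (h : nd.IsPauliNode) (γ : CQ n κ) :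
    nd.sem γ = (nd.kraus.map fun k => atom k.1 k.2.1 k.2.2 γ).sum := by
  cases nd with
  | rot P θ =>
    simp only [kraus, List.map_cons, List.map_nil, List.sum_cons, List.sum_nil, add_zero]
    refine cq_hom_ext (f := (rot P θ).semHom) (fun m ρ => ?_) γ
    rw [semHom_rot_single, atom_single]; rfl
  | prep PZ PX =>
    simp only [kraus, List.map_cons, List.map_nil, List.sum_cons, List.sum_nil, add_zero]
    refine cq_hom_ext (f := (prep PZ PX).semHom) (g := atom _ _ _ + atom _ _ _) (fun m ρ => ?_) γ
    rw [AddMonoidHom.add_apply, semHom_prep_single, atom_single, atom_single, smul_add,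
      Finsupp.single_add]
    simp only [id, smul_mul_assoc, ← mul_assoc]
  | meas c P =>
    simp only [kraus, List.map_cons, List.map_nil, List.sum_cons, List.sum_nil, add_zero]
    refine cq_hom_ext (f := (meas c P).semHom) (g := atom _ _ _ + atom _ _ _) (fun m ρ => ?_) γ
    simp only [AddMonoidHom.add_apply, semHom_meas_single, atom_single, smul_mul_assoc]
  | frame F => exact h.elim
  | mu μ => exact h.elim

/-- An additive map that commutes with the Kraus terms of a node commutes with its channel. -/
theorem sem_hom_comm {nd : Node n κ} (h : nd.IsPauliNode) (g : CQ n κ →+ CQ n κ)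
    (hg : ∀ k ∈ nd.kraus, ∀ γ, g (atom k.1 k.2.1 k.2.2 γ) = atom k.1 k.2.1 k.2.2 (g γ))
    (γ : CQ n κ) : g (nd.sem γ) = nd.sem (g γ) := by
  rw [sem_eq_kraus h, sem_eq_kraus h, map_list_sum, List.map_map]
  congr 1
  exact List.map_congr_left fun k hk => hg k hk γ

theorem commute_kraus {nd : Node n κ} {A : Op n} (h : ∀ P ∈ nd.paulis, Commute A P.toMat) :
    ∀ k ∈ nd.kraus, Commute A k.2.1 ∧ Commute A k.2.2 := by
  have h1 : ∀ {B : Op n}, Commute A B → Commute A (1 + B) ∧ Commute A (1 - B) := fun hB =>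
    ⟨(Commute.one_right A).add_right hB, (Commute.one_right A).sub_right hB⟩
  cases nd with
  | rot P θ =>
    have hP : Commute A P.toMat := h P (by simp [paulis])
    have hR : ∀ θ, Commute A (rotMat P θ) := fun θ =>
      ((Commute.one_right A).smul_right _).sub_right (hP.smul_right _)
    simp [kraus, hR]
  | prep PZ PX =>
    have hZ : Commute A PZ.toMat := h PZ (by simp [paulis])
    have hX : Commute A PX.toMat := h PX (by simp [paulis])
    simp only [kraus, List.mem_cons, List.not_mem_nil, or_false, forall_eq_or_imp, forall_eq]
    exact ⟨⟨(h1 hZ).1.smul_right _, (h1 hZ).1⟩,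
      ⟨(hX.mul_right (h1 hZ).2).smul_right _, (h1 hZ).2.mul_right hX⟩⟩
  | meas c P =>
    have hP : Commute A P.toMat := h P (by simp [paulis])
    simp only [kraus, List.mem_cons, List.not_mem_nil, or_false, forall_eq_or_imp, forall_eq]
    exact ⟨⟨(h1 hP).1.smul_right _, (h1 hP).1⟩, ⟨(h1 hP).2.smul_right _, (h1 hP).2⟩⟩
  | frame F => simp [kraus]
  | mu μ => simp [kraus]

theorem kraus_map {nd : Node n κ} : ∀ k ∈ nd.kraus,
    k.1 = id ∨ ∃ c b, nd.mvar = some c ∧ k.1 = fun m => assign m c (some b) := by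
  cases nd <;> simp [kraus, mvar]

omit [DecidableEq κ] in
theorem comm_iff {a b : Node n κ} (ha : a.IsPauliNode) (hb : b.IsPauliNode) :
    a.Comm b ↔ ∀ P ∈ a.paulis, ∀ Q ∈ b.paulis, Pauli.lam P Q = 0 := by
  cases a <;> cases b <;> first
    | exact ha.elim
    | exact hb.elim
    | simp [Comm, PauliComm, paulis, Pauli.Comm]

omit [DecidableEq κ] in
theorem comm_symm {a b : Node n κ} (ha : a.IsPauliNode) (hb : b.IsPauliNode) :
    a.Comm b ↔ b.Comm a := by
  rw [comm_iff ha hb, comm_iff hb ha]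
  constructor <;> intro h P hP Q hQ <;> rw [Pauli.lam_comm] <;> exact h _ hQ _ hP

/-- Commuting nodes have commuting channels, provided that two measurements do not record their
outcomes in the same variable. -/
theorem sem_comm {a b : Node n κ} (ha : a.IsPauliNode) (hb : b.IsPauliNode) (hab : a.Comm b)
    (hv : ∀ c, a.mvar = some c → b.mvar ≠ some c) (γ : CQ n κ) :
    a.sem (b.sem γ) = b.sem (a.sem γ) := by
  rw [comm_iff ha hb] at hab
  refine sem_hom_comm hb a.semHom (fun l hl γ => ?_) γ
  refine (sem_hom_comm ha (atom l.1 l.2.1 l.2.2) (fun k hk δ => ?_) γ).symm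
  have h1 : ∀ P ∈ a.paulis, Commute P.toMat l.2.1 ∧ Commute P.toMat l.2.2 := fun P hP =>
    commute_kraus (fun Q hQ => Pauli.commute_of_comm (hab P hP Q hQ)) l hl
  have h2 := (commute_kraus (fun P hP => ((h1 P hP).1).symm) k hk).1.symm
  have h3 := (commute_kraus (fun P hP => ((h1 P hP).2).symm) k hk).2.symm
  refine atom_comm ?_ h2.symm h3.symm δ
  rcases kraus_map k hk with h | ⟨c, x, hc, h⟩
  · rw [h]; rfl
  · rcases kraus_map l hl with h' | ⟨c', x', hc', h'⟩
    · rw [h']; rfl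
    · have hne : c ≠ c' := by
        rintro rfl; exact hv c hc hc'
      rw [h, h']
      funext m
      exact Function.update_comm hne _ _ _

end Node

theorem termSem_comm {nd : Node n κ} {t : Term n κ}
    (h : ∀ a ∈ t, ∀ γ, a.sem (nd.sem γ) = nd.sem (a.sem γ)) (γ : CQ n κ) :
    termSem t (nd.sem γ) = nd.sem (termSem t γ) := by
  induction t generalizing γ with
  | nil => rfl
  | cons a t ih =>
    rw [termSem_cons, termSem_cons, h a (by simp), ih fun b hb => h b (by simp [hb])]

/-! ### Frames and measurement space functions as channels -/

theorem sem_frame {F : Frame n} (hF : F.WF) {U : Op n} (hU : F.IsUnitaryOf U) (m : ClState κ)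
    (ρ : Op n) : (Node.frame F).semHom (Finsupp.single m ρ) = Finsupp.single m (U * ρ * Uᴴ) := by
  rw [semHom_frame_single, (Frame.isUnitaryOf_unitary hF).conj_eq hU]

theorem sem_frame_origin (γ : CQ n κ) : (Node.frame Frame.origin).sem γ = γ := by
  refine cq_hom_ext (f := (Node.frame Frame.origin).semHom) (g := AddMonoidHom.id _)
    (fun m ρ => ?_) γ
  rw [sem_frame Frame.origin_wf Frame.origin_isUnitaryOf]
  simp

theorem sem_frame_comp {F₁ F₂ : Frame n} (h₁ : F₁.WF) (h₂ : F₂.WF) (γ : CQ n κ) :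
    (Node.frame F₂).sem ((Node.frame F₁).sem γ) = (Node.frame (F₂.comp F₁)).sem γ := by
  refine cq_hom_ext (f := (Node.frame F₂).semHom.comp (Node.frame F₁).semHom)
    (g := (Node.frame (F₂.comp F₁)).semHom) (fun m ρ => ?_) γ
  have hU₁ := Frame.isUnitaryOf_unitary h₁
  have hU₂ := Frame.isUnitaryOf_unitary h₂
  rw [AddMonoidHom.comp_apply, sem_frame h₁ hU₁, sem_frame h₂ hU₂,
    sem_frame (Frame.comp_wf h₁ h₂) (Frame.comp_isUnitaryOf hU₁ hU₂)]
  simp only [Matrix.conjTranspose_mul, mul_assoc]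

theorem sem_frame_muChan [DecidableEq κ'] (F : Frame n) (f : ClState κ → ClState κ')
    (γ : CQ n κ) : (Node.frame F).sem (muChan f γ) = muChan f ((Node.frame F).sem γ) :=
  cq_hom_ext (f := (Node.frame F).semHom.comp (muHom f))
    (g := (muHom f).comp (Node.frame F).semHom)
    (fun m ρ => by simp only [AddMonoidHom.comp_apply, muHom_single, semHom_frame_single]) γ

/-- A node after a frame is the node transformed by the frame, before the frame. -/
theorem sem_fwd {F : Frame n} (hF : F.WF) {nd : Node n κ} (hnd : nd.IsPauliNode) (γ : CQ n κ) :
    nd.sem ((Node.frame F).sem γ) = (Node.frame F).sem ((nd.fwd F).sem γ) := by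
  have hU := Frame.isUnitaryOf_unitary hF
  refine cq_hom_ext (f := nd.semHom.comp (Node.frame F).semHom)
    (g := (Node.frame F).semHom.comp (nd.fwd F).semHom) (fun m ρ => ?_) γ
  have h1 := hU.conjTranspose_mul_self
  have h2 := hU.mul_conjTranspose_self
  have hact := hU.2
  have hfr : ∀ m ρ, (Node.frame F).semHom (Finsupp.single m ρ : CQ n κ) = _ := sem_frame hF hU
  generalize F.unitary = U at *
  have hadd : ∀ P : Pauli n, 1 + (F.act P).toMat = Uᴴ * (1 + P.toMat) * U := fun P => by
    rw [hact, mul_add, add_mul, mul_one, h1]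
  have hsub : ∀ P : Pauli n, 1 - (F.act P).toMat = Uᴴ * (1 - P.toMat) * U := fun P => by
    rw [hact, mul_sub, sub_mul, mul_one, h1]
  have hrot : ∀ (P : Pauli n) θ, rotMat (F.act P) θ = Uᴴ * rotMat P θ * U := fun P θ => by
    simp only [rotMat, hact, mul_sub, sub_mul, mul_smul_comm, smul_mul_assoc, mul_one, h1]
  have h3 : ∀ A, U * (Uᴴ * A) = A := fun A => by rw [← mul_assoc, h2, one_mul]
  cases nd with
  | rot P θ =>
    simp only [AddMonoidHom.comp_apply, Node.fwd, semHom_rot_single, hfr, hrot]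
    simp only [mul_assoc, h3, h2, mul_one]
  | prep PZ PX =>
    simp only [AddMonoidHom.comp_apply, Node.fwd, semHom_prep_single, hfr, hadd, hsub]
    simp only [hact, mul_smul_comm, smul_mul_assoc, mul_add, add_mul, mul_assoc, h3, h2, mul_one,
      one_mul]
  | meas c P =>
    simp only [AddMonoidHom.comp_apply, Node.fwd, semHom_meas_single, hfr, hadd, hsub, map_add,
      mul_smul_comm, smul_mul_assoc]
    simp only [mul_assoc, h3, h2, mul_one]
  | frame F => exact hnd.elim
  | mu μ => exact hnd.elim

theorem sem_rot_muChan [DecidableEq κ'] (P : Pauli n) (θ : ℝ) (f : ClState κ → ClState κ')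
    (γ : CQ n κ) : (Node.rot P θ).sem (muChan f γ) = muChan f ((Node.rot P θ).sem γ) :=
  cq_hom_ext (f := (Node.rot P θ).semHom.comp (muHom f))
    (g := (muHom f).comp (Node.rot P θ).semHom)
    (fun m ρ => by simp only [AddMonoidHom.comp_apply, muHom_single, semHom_rot_single]) γ

theorem sem_prep_muChan [DecidableEq κ'] (PZ PX : Pauli n) (f : ClState κ → ClState κ')
    (γ : CQ n κ) : (Node.prep PZ PX).sem (muChan f γ) = muChan f ((Node.prep PZ PX).sem γ) :=
  cq_hom_ext (f := (Node.prep PZ PX).semHom.comp (muHom f))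
    (g := (muHom f).comp (Node.prep PZ PX).semHom)
    (fun m ρ => by simp only [AddMonoidHom.comp_apply, muHom_single, semHom_prep_single]) γ

end Channels

/-! ### Soundness of merging -/

section Merging

variable {n : ℕ}

theorem rotMat_mul {P : Pauli n} (hP : P.Herm) (θ₁ θ₂ : ℝ) :
    rotMat P θ₁ * rotMat P θ₂ = rotMat P (θ₁ + θ₂) := by
  have h := Pauli.toMat_mul_self hP
  have hI : ∀ a b : ℂ, Complex.I * a * (Complex.I * b) = -(a * b) := fun a b => by
    linear_combination a * b * Complex.I_mul_I
  simp only [rotMat, add_div, Real.cos_add, Real.sin_add, mul_sub, sub_mul, smul_mul_smul_comm,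
    mul_one, one_mul, h, hI]
  push_cast
  module

theorem rotMat_signed (P : Pauli n) (b : Bool) (θ : ℝ) :
    rotMat (P.signed b) θ = rotMat P (if b then -θ else θ) := by
  cases b <;> simp [rotMat, Pauli.toMat_signed, neg_div]

theorem rotMat_zero (P : Pauli n) : rotMat P 0 = 1 := by simp [rotMat]

theorem conjTranspose_rotMat {P : Pauli n} (hP : P.Herm) (θ : ℝ) :
    (rotMat P θ)ᴴ = rotMat P (-θ) := by
  simp only [rotMat, Matrix.conjTranspose_sub, Matrix.conjTranspose_smul,
    Matrix.conjTranspose_one, (Pauli.herm_iff P).mp hP]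
  simp [neg_div, -Complex.ofReal_cos, -Complex.ofReal_sin]

theorem rotMat_mem_unitaryGroup {P : Pauli n} (hP : P.Herm) (θ : ℝ) :
    rotMat P θ ∈ Matrix.unitaryGroup (Fin n → Fin 2) ℂ := by
  rw [Matrix.mem_unitaryGroup_iff, Matrix.star_eq_conjTranspose, conjTranspose_rotMat hP,
    rotMat_mul hP, add_neg_cancel, rotMat_zero]

/-- The eigenvalue `exp (- i θ / 2)` of `rotMat P θ` on the `+1` eigenspace of `P`. -/
def rotPhase (θ : ℝ) : ℂ := (Real.cos (θ / 2) : ℂ) - Complex.I * (Real.sin (θ / 2) : ℂ)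

theorem rotPhase_mul_neg (θ : ℝ) : rotPhase θ * rotPhase (-θ) = 1 := by
  have h : (Real.cos (θ / 2) : ℂ) ^ 2 + (Real.sin (θ / 2) : ℂ) ^ 2 = 1 := by
    exact_mod_cast Real.cos_sq_add_sin_sq (θ / 2)
  simp only [rotPhase, neg_div, Real.cos_neg, Real.sin_neg]
  push_cast at h ⊢
  linear_combination h - Complex.sin (θ / 2) ^ 2 * Complex.I_mul_I

theorem rotPhase_neg_mul (θ : ℝ) : rotPhase (-θ) * rotPhase θ = 1 := by
  rw [mul_comm, rotPhase_mul_neg]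

theorem rotMat_mul_one_add {P : Pauli n} (hP : P.Herm) (θ : ℝ) :
    rotMat P θ * (1 + P.toMat) = rotPhase θ • (1 + P.toMat) := by
  simp only [rotMat, rotPhase, mul_add, sub_mul, smul_mul_assoc, Pauli.toMat_mul_self hP, mul_one,
    one_mul]
  module

theorem one_add_mul_rotMat {P : Pauli n} (hP : P.Herm) (θ : ℝ) :
    (1 + P.toMat) * rotMat P θ = rotPhase θ • (1 + P.toMat) := by
  simp only [rotMat, rotPhase, add_mul, mul_sub, mul_smul_comm, Pauli.toMat_mul_self hP, mul_one,
    one_mul]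
  module

theorem one_sub_mul_rotMat {P : Pauli n} (hP : P.Herm) (θ : ℝ) :
    (1 - P.toMat) * rotMat P θ = rotPhase (-θ) • (1 - P.toMat) := by
  simp only [rotMat, rotPhase, sub_mul, mul_sub, mul_smul_comm, Pauli.toMat_mul_self hP, mul_one,
    one_mul, neg_div, Real.cos_neg, Real.sin_neg]
  push_cast
  module

theorem rotMat_mul_one_sub {P : Pauli n} (hP : P.Herm) (θ : ℝ) :
    rotMat P θ * (1 - P.toMat) = rotPhase (-θ) • (1 - P.toMat) := by
  simp only [rotMat, rotPhase, sub_mul, mul_sub, smul_mul_assoc, Pauli.toMat_mul_self hP, mul_one,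
    one_mul, neg_div, Real.cos_neg, Real.sin_neg]
  push_cast
  module

theorem one_add_mul_one_add {z : Op n} (hz : z * z = 1) :
    (1 + z) * (1 + z) = (2 : ℂ) • (1 + z) := by
  simp only [add_mul, mul_add, one_mul, mul_one, hz]; module

theorem one_sub_mul_one_sub {z : Op n} (hz : z * z = 1) :
    (1 - z) * (1 - z) = (2 : ℂ) • (1 - z) := by
  simp only [sub_mul, mul_sub, one_mul, mul_one, hz]; module

theorem one_add_mul_one_sub {z : Op n} (hz : z * z = 1) : (1 + z) * (1 - z) = 0 := by
  simp only [add_mul, mul_sub, one_mul, mul_one, hz]; abel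

theorem one_sub_mul_one_add {z : Op n} (hz : z * z = 1) : (1 - z) * (1 + z) = 0 := by
  simp only [sub_mul, mul_add, one_mul, mul_one, hz]; abel

/-- Here `e` is twice a projection, so the statement says that projecting again has no effect. -/
theorem project_twice {e : Op n} (he : e * e = (2 : ℂ) • e) (ρ : Op n) :
    (1 / 4 : ℂ) • (e * ((1 / 4 : ℂ) • (e * ρ * e)) * e) = (1 / 4 : ℂ) • (e * ρ * e) := by
  have : e * (e * ρ * e) * e = (e * e) * ρ * (e * e) := by simp only [mul_assoc]
  rw [mul_smul_comm, smul_mul_assoc, this, he, smul_mul_assoc, smul_mul_smul_comm, smul_smul,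
    smul_smul]
  norm_num

theorem project_orthogonal {e f : Op n} (h : f * e = 0) (g ρ : Op n) :
    (1 / 4 : ℂ) • (f * ((1 / 4 : ℂ) • (e * ρ * e)) * g) = 0 := by
  have : f * (e * ρ * e) = 0 := by rw [← mul_assoc, ← mul_assoc, h, zero_mul, zero_mul]
  rw [mul_smul_comm, this, smul_zero, zero_mul, smul_zero]

variable {κ : Type*} [DecidableEq κ]

/-- Since `PX` exchanges the eigenspaces of `PZ`, both terms of a preparation end with the
projection on the `+1` eigenspace of `PZ`. -/
theorem semHom_prep_single' {PZ PX : Pauli n} (h : Pauli.lam PZ PX = 1) (m : ClState κ) (ρ : Op n) :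
    (Node.prep PZ PX).semHom (Finsupp.single m ρ) = Finsupp.single m ((1 / 4 : ℂ) •
      ((1 + PZ.toMat) * (ρ + PX.toMat * ρ * PX.toMat) * (1 + PZ.toMat))) := by
  rw [semHom_prep_single]
  have hzx := Pauli.toMat_anticomm h
  have h1 : PX.toMat * (1 - PZ.toMat) = (1 + PZ.toMat) * PX.toMat := by
    rw [mul_sub, add_mul, hzx, mul_one, one_mul, sub_eq_add_neg]
  have h2 : (1 - PZ.toMat) * PX.toMat = PX.toMat * (1 + PZ.toMat) := by
    rw [sub_mul, mul_add, hzx, mul_one, one_mul, sub_neg_eq_add]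
  rw [h1, mul_assoc _ (1 - PZ.toMat) PX.toMat, h2]
  simp only [mul_add (1 + PZ.toMat), add_mul _ _ (1 + PZ.toMat), mul_assoc]

theorem one_add_mul_mul_one_add {PZ PX : Pauli n} (hZ : PZ.Herm) (h : Pauli.lam PZ PX = 1) :
    (1 + PZ.toMat) * PX.toMat * (1 + PZ.toMat) = 0 := by
  have h1 : PX.toMat * (1 + PZ.toMat) = (1 - PZ.toMat) * PX.toMat := by
    rw [sub_mul, mul_add, Pauli.toMat_anticomm h, mul_one, one_mul, sub_neg_eq_add]
  rw [mul_assoc, h1, ← mul_assoc, one_add_mul_one_sub (Pauli.toMat_mul_self hZ), zero_mul]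

theorem sem_rot_rot {P : Pauli n} (hP : P.Herm) (b : Bool) {θ₁ θ₂ θ : ℝ}
    (hθ : θ = if b then θ₁ - θ₂ else θ₁ + θ₂) (γ : CQ n κ) :
    (Node.rot (P.signed b) θ₂).sem ((Node.rot P θ₁).sem γ) = (Node.rot P θ).sem γ := by
  refine cq_hom_ext (f := (Node.rot (P.signed b) θ₂).semHom.comp (Node.rot P θ₁).semHom)
    (g := (Node.rot P θ).semHom) (fun m ρ => ?_) γ
  simp only [AddMonoidHom.comp_apply, semHom_rot_single, rotMat_signed]
  congr 1
  rw [← mul_assoc, ← mul_assoc, rotMat_mul hP, mul_assoc, rotMat_mul hP]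
  cases b <;> simp only [Bool.false_eq_true, if_false, if_true] at hθ ⊢ <;>
    congr 2 <;> (try congr 1) <;> rw [hθ] <;> ring

theorem sem_rot_eq_frame {P : Pauli n} (hP : P.Herm) {θ : ℝ} {F : Frame n}
    (hF : F.IsFrameOf (rotMat P θ)) (γ : CQ n κ) : (Node.rot P θ).sem γ = (Node.frame F).sem γ := by
  have hU := rotMat_mem_unitaryGroup hP θ
  refine cq_hom_ext (f := (Node.rot P θ).semHom) (g := (Node.frame F).semHom) (fun m ρ => ?_) γ
  rw [sem_frame (hF.wf hU) (hF.isUnitaryOf hU), semHom_rot_single, conjTranspose_rotMat hP]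

theorem sem_prep_prep_same {PZ PX PX' : Pauli n} (hZ : PZ.Herm) (h : Pauli.lam PZ PX = 1)
    (h' : Pauli.lam PZ PX' = 1) (γ : CQ n κ) :
    (Node.prep PZ PX').sem ((Node.prep PZ PX).sem γ) = (Node.prep PZ PX).sem γ := by
  refine cq_hom_ext (f := (Node.prep PZ PX').semHom.comp (Node.prep PZ PX).semHom)
    (g := (Node.prep PZ PX).semHom) (fun m ρ => ?_) γ
  rw [AddMonoidHom.comp_apply, semHom_prep_single' h, semHom_prep_single' h']
  congr 1
  rw [mul_add (1 + PZ.toMat), add_mul _ _ (1 + PZ.toMat), smul_add,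
    project_twice (one_add_mul_one_add (Pauli.toMat_mul_self hZ)), ← mul_assoc, ← mul_assoc,
    mul_smul_comm, ← mul_assoc, ← mul_assoc, one_add_mul_mul_one_add hZ h']
  simp

theorem sem_prep_signed (PZ PX : Pauli n) (b : Bool) (γ : CQ n κ) :
    (Node.prep PZ (PX.signed b)).sem γ = (Node.prep PZ PX).sem γ := by
  refine cq_hom_ext (f := (Node.prep PZ (PX.signed b)).semHom) (g := (Node.prep PZ PX).semHom)
    (fun m ρ => ?_) γ
  rw [semHom_prep_single, semHom_prep_single]
  cases b <;> simp [Pauli.toMat_signed]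

/-- A preparation of the `+1` eigenstate followed by the preparation of the `-1` eigenstate with the
same correction. -/
theorem sem_prep_prep_neg {PZ PX : Pauli n} (hZ : PZ.Herm) (hX : PX.Herm)
    (h : Pauli.lam PZ PX = 1) (γ : CQ n κ) :
    (Node.prep (PZ.signed true) PX).sem ((Node.prep PZ PX).sem γ) =
      (Node.prep (PZ.signed true) PX).sem γ := by
  refine cq_hom_ext (f := (Node.prep (PZ.signed true) PX).semHom.comp (Node.prep PZ PX).semHom)
    (g := (Node.prep (PZ.signed true) PX).semHom) (fun m ρ => ?_) γ
  have hzx := Pauli.toMat_anticomm h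
  have hzz := Pauli.toMat_mul_self hZ
  have hxx := Pauli.toMat_mul_self hX
  have h' : Pauli.lam (PZ.signed true) PX = 1 := h
  rw [AddMonoidHom.comp_apply, semHom_prep_single' h, semHom_prep_single' h',
    semHom_prep_single' h', Pauli.toMat_signed, if_pos rfl, ← sub_eq_add_neg]
  congr 1
  generalize PZ.toMat = z at *
  generalize PX.toMat = x at *
  have h1 : x * (1 + z) = (1 - z) * x := by
    rw [sub_mul, mul_add, hzx, mul_one, one_mul, sub_neg_eq_add]
  have h2 : (1 + z) * x = x * (1 - z) := by
    rw [mul_sub, add_mul, hzx, mul_one, one_mul, sub_eq_add_neg]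
  have h3 : x * (ρ + x * ρ * x) * x = ρ + x * ρ * x := by
    have h4 : ∀ a, x * (x * a) = a := fun a => by rw [← mul_assoc, hxx, one_mul]
    simp only [mul_add, add_mul, mul_assoc, hxx, h4, mul_one]
    rw [add_comm]
  have h5 : x * ((1 / 4 : ℂ) • ((1 + z) * (ρ + x * ρ * x) * (1 + z))) * x =
      (1 / 4 : ℂ) • ((1 - z) * (ρ + x * ρ * x) * (1 - z)) := by
    rw [mul_smul_comm, smul_mul_assoc]
    congr 1
    calc _ = (x * (1 + z)) * (ρ + x * ρ * x) * ((1 + z) * x) := by simp only [mul_assoc]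
      _ = (1 - z) * (x * (ρ + x * ρ * x) * x) * (1 - z) := by rw [h1, h2]; simp only [mul_assoc]
      _ = _ := by rw [h3]
  rw [h5, mul_add (1 - z), add_mul _ _ (1 - z), smul_add,
    project_orthogonal (one_sub_mul_one_add hzz), project_twice (one_sub_mul_one_sub hzz), zero_add]

theorem sem_prep_rot {PZ PX : Pauli n} (hZ : PZ.Herm) (h : Pauli.lam PZ PX = 1) (b : Bool) (θ : ℝ)
    (γ : CQ n κ) :
    (Node.rot (PZ.signed b) θ).sem ((Node.prep PZ PX).sem γ) = (Node.prep PZ PX).sem γ := by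
  refine cq_hom_ext (f := (Node.rot (PZ.signed b) θ).semHom.comp (Node.prep PZ PX).semHom)
    (g := (Node.prep PZ PX).semHom) (fun m ρ => ?_) γ
  rw [AddMonoidHom.comp_apply, semHom_prep_single' h, semHom_rot_single, rotMat_signed,
    rotMat_signed]
  congr 1
  have key : ∀ θ (σ : Op n), rotMat PZ θ * ((1 / 4 : ℂ) • ((1 + PZ.toMat) * σ * (1 + PZ.toMat))) *
      rotMat PZ (-θ) = (1 / 4 : ℂ) • ((1 + PZ.toMat) * σ * (1 + PZ.toMat)) := fun θ σ => by
    rw [mul_smul_comm, smul_mul_assoc, ← mul_assoc, ← mul_assoc, rotMat_mul_one_add hZ,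
      mul_assoc _ _ (rotMat PZ (-θ)), one_add_mul_rotMat hZ, smul_mul_assoc, smul_mul_smul_comm,
      rotPhase_mul_neg, one_smul]
  cases b
  · exact key _ _
  · simpa using key (-θ) _

theorem sem_meas_meas {P : Pauli n} (hP : P.Herm) (c₁ c₂ : κ) (b : Bool) (γ : CQ n κ) :
    (Node.meas c₂ (P.signed b)).sem ((Node.meas c₁ P).sem γ) =
      muChan (fun m => assign m c₂ ((m c₁).map fun x => xor x b)) ((Node.meas c₁ P).sem γ) := by
  refine cq_hom_ext (f := (Node.meas c₂ (P.signed b)).semHom.comp (Node.meas c₁ P).semHom)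
    (g := (muHom _).comp (Node.meas c₁ P).semHom) (fun m ρ => ?_) γ
  have hp := Pauli.toMat_mul_self hP
  simp only [AddMonoidHom.comp_apply, semHom_meas_single, map_add, muHom_single,
    Pauli.toMat_signed]
  cases b <;>
    simp only [Bool.false_eq_true, if_false, if_true, ← sub_eq_add_neg, sub_neg_eq_add,
      project_twice (one_add_mul_one_add hp), project_twice (one_sub_mul_one_sub hp),
      project_orthogonal (one_sub_mul_one_add hp), project_orthogonal (one_add_mul_one_sub hp),
      Finsupp.single_zero, add_zero, zero_add] <;>
    simp [assign]

theorem sem_prep_meas {PZ PX : Pauli n} (hZ : PZ.Herm) (h : Pauli.lam PZ PX = 1) (c : κ) (b : Bool)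
    (γ : CQ n κ) : (Node.meas c (PZ.signed b)).sem ((Node.prep PZ PX).sem γ) =
      muChan (fun m => assign m c (some b)) ((Node.prep PZ PX).sem γ) := by
  refine cq_hom_ext (f := (Node.meas c (PZ.signed b)).semHom.comp (Node.prep PZ PX).semHom)
    (g := (muHom _).comp (Node.prep PZ PX).semHom) (fun m ρ => ?_) γ
  have hz := Pauli.toMat_mul_self hZ
  simp only [AddMonoidHom.comp_apply, semHom_prep_single' h, semHom_meas_single, muHom_single,
    Pauli.toMat_signed]
  cases b <;>
    simp only [Bool.false_eq_true, if_false, if_true, ← sub_eq_add_neg, sub_neg_eq_add,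
      project_twice (one_add_mul_one_add hz), project_orthogonal (one_sub_mul_one_add hz),
      Finsupp.single_zero, add_zero, zero_add]

theorem sem_rot_meas {P : Pauli n} (hP : P.Herm) (b : Bool) (θ : ℝ) (c : κ) (γ : CQ n κ) :
    (Node.meas c P).sem ((Node.rot (P.signed b) θ).sem γ) = (Node.meas c P).sem γ := by
  refine cq_hom_ext (f := (Node.meas c P).semHom.comp (Node.rot (P.signed b) θ).semHom)
    (g := (Node.meas c P).semHom) (fun m ρ => ?_) γ
  have key : ∀ θ, (1 + P.toMat) * (rotMat P θ * ρ * rotMat P (-θ)) * (1 + P.toMat) =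
        (1 + P.toMat) * ρ * (1 + P.toMat) ∧
      (1 - P.toMat) * (rotMat P θ * ρ * rotMat P (-θ)) * (1 - P.toMat) =
        (1 - P.toMat) * ρ * (1 - P.toMat) := fun θ => by
    constructor
    · calc _ = ((1 + P.toMat) * rotMat P θ) * ρ * (rotMat P (-θ) * (1 + P.toMat)) := by
            simp only [mul_assoc]
        _ = _ := by
            rw [one_add_mul_rotMat hP, rotMat_mul_one_add hP, smul_mul_assoc, smul_mul_smul_comm,
              rotPhase_mul_neg, one_smul]
    · calc _ = ((1 - P.toMat) * rotMat P θ) * ρ * (rotMat P (-θ) * (1 - P.toMat)) := by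
            simp only [mul_assoc]
        _ = _ := by
            rw [one_sub_mul_rotMat hP, rotMat_mul_one_sub hP, smul_mul_assoc, smul_mul_smul_comm,
              neg_neg, rotPhase_neg_mul, one_smul]
  rw [AddMonoidHom.comp_apply, semHom_rot_single, semHom_meas_single, semHom_meas_single,
    rotMat_signed, rotMat_signed]
  cases b
  · simp only [Bool.false_eq_true, if_false, key]
  · simp only [if_true]
    rw [(key (-θ)).1, (key (-θ)).2]

/-- `μ` determines the variables in `s` from the variables in `s`. -/
def Respects (s : Set κ) (μ : MFun κ) : Prop :=
  ∀ m m' : ClState κ, (∀ c ∈ s, m c = m' c) → ∀ c ∈ s, μ m c = μ m' c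

omit [DecidableEq κ] in
theorem respects_id (s : Set κ) : Respects s id := fun _ _ h => h

omit [DecidableEq κ] in
theorem Respects.comp {s : Set κ} {μ ν : MFun κ} (hμ : Respects s μ) (hν : Respects s ν) :
    Respects s (μ ∘ ν) := fun m m' h => hμ _ _ (hν m m' h)

theorem respects_assign {s : Set κ} {μ : MFun κ} (hμ : Respects s μ) (c : κ)
    {f : ClState κ → Option Bool} (hf : ∀ m m' : ClState κ, (∀ c ∈ s, m c = m' c) → f m = f m') :
    Respects s fun m => assign (μ m) c (f m) := by
  intro m m' h d hd
  by_cases hdc : d = c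
  · subst hdc; simpa [assign] using hf m m' h
  · simpa [assign, hdc] using hμ m m' h d hd

/-- Merge steps of rotations, preparations and measurements are sound. -/
theorem MergeStep.sound {n₁ n₂ n₀ : Node n κ} {μ₀ : MFun κ} (h : MergeStep n₁ n₂ n₀ μ₀)
    (h₁ : n₁.IsPauliNode) (h₂ : n₂.IsPauliNode) (w₁ : n₁.WF) (w₂ : n₂.WF) :
    n₀.WF ∧ (n₀.IsPauliNode ∨ ∃ F, n₀ = .frame F) ∧
    (n₀.mvar = none ∨ n₀.mvar = n₁.mvar ∨ n₀.mvar = n₂.mvar) ∧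
    (∀ s : Set κ, (∀ c, n₁.mvar = some c → c ∈ s) → Respects s μ₀) ∧
    ∀ γ, n₂.sem (n₁.sem γ) = muChan μ₀ (n₀.sem γ) := by
  cases h with
  | rotRotClifford P b θ₁ θ₂ θ F hθ hk hF =>
    refine ⟨hF.wf (rotMat_mem_unitaryGroup w₁ θ), Or.inr ⟨F, rfl⟩, Or.inl rfl,
      fun s _ => respects_id s, fun γ => ?_⟩
    rw [muChan_id, sem_rot_rot w₁ b hθ, sem_rot_eq_frame w₁ hF]
  | rotRot P b θ₁ θ₂ θ hθ hk =>
    refine ⟨w₁, Or.inl trivial, Or.inl rfl, fun s _ => respects_id s, fun γ => ?_⟩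
    rw [muChan_id, sem_rot_rot w₁ b hθ]
  | prepPrep PZ PX b b' =>
    refine ⟨w₂, Or.inl trivial, Or.inl rfl, fun s _ => respects_id s, fun γ => ?_⟩
    rw [muChan_id, sem_prep_signed, sem_prep_signed]
    cases b
    · have hs : PZ.signed false = PZ := by
        ext j
        · exact zero_add PZ.phase
        · rfl
      rw [hs, sem_prep_prep_same w₁.1 w₁.2.2 w₁.2.2]
    · exact sem_prep_prep_neg w₁.1 w₁.2.1 w₁.2.2 γ
  | prepPrepSame PZ PX PX' =>
    refine ⟨w₁, Or.inl trivial, Or.inl rfl, fun s _ => respects_id s, fun γ => ?_⟩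
    rw [muChan_id, sem_prep_prep_same w₁.1 w₁.2.2 w₂.2.2]
  | prepRot PZ PX b θ =>
    refine ⟨w₁, Or.inl trivial, Or.inl rfl, fun s _ => respects_id s, fun γ => ?_⟩
    rw [muChan_id, sem_prep_rot w₁.1 w₁.2.2]
  | measMeas c₁ c₂ P b =>
    refine ⟨w₁, Or.inl trivial, Or.inr (Or.inl rfl), fun s hs => ?_,
      fun γ => sem_meas_meas w₁ c₁ c₂ b γ⟩
    exact respects_assign (respects_id s) _ fun m m' hm => by rw [hm c₁ (hs c₁ rfl)]
  | prepMeas PZ PX c b =>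
    refine ⟨w₁, Or.inl trivial, Or.inl rfl, fun s _ => ?_,
      fun γ => sem_prep_meas w₁.1 w₁.2.2 c b γ⟩
    exact respects_assign (respects_id s) _ fun _ _ _ => rfl
  | rotMeas P b θ c =>
    refine ⟨w₂, Or.inl trivial, Or.inr (Or.inr rfl), fun s _ => respects_id s, fun γ => ?_⟩
    rw [muChan_id, sem_rot_meas w₂]
  | frameFrame F₁ F₂ => exact h₁.elim
  | muMu μ₁ μ₂ => exact h₁.elim

end Merging

/-! ### PCOAST graphs and topological orders -/

namespace Graph

variable {n : ℕ} {κ : Type*}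

/-- The classical variables written by the measurements of a graph. -/
def mvars (G : Graph n κ) : Set κ := {c | ∃ v ∈ G.verts, (G.label v).mvar = some c}

/-- The invariant of the graphs built by `addNode`. The acyclicity of a PCOAST graph is replaced by
the existence of a topological order, and distinct measurements write distinct variables: the
relation `Node.Comm` ignores the variables, so that the channel of a graph would otherwise depend on
the topological order. -/
structure Good (G : Graph n κ) : Prop where
  pauli : ∀ v ∈ G.verts, (G.label v).IsPauliNode
  wf : ∀ v ∈ G.verts, (G.label v).WF
  edges_mem : ∀ e ∈ G.edges, e.1 ∈ G.verts ∧ e.2 ∈ G.verts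
  irrefl : ∀ v, (v, v) ∉ G.edges
  edge_iff : ∀ v ∈ G.verts, ∀ w ∈ G.verts, v ≠ w →
    (¬ (G.label v).Comm (G.label w) → Xor ((v, w) ∈ G.edges) ((w, v) ∈ G.edges)) ∧
    ((G.label v).Comm (G.label w) → (v, w) ∉ G.edges ∧ (w, v) ∉ G.edges)
  mvar_inj : ∀ v ∈ G.verts, ∀ w ∈ G.verts, ∀ c,
    (G.label v).mvar = some c → (G.label w).mvar = some c → v = w
  order : ∃ l, G.IsTopOrder l

theorem IsTopOrder.idxOf_lt {G : Graph n κ} {l : List ℕ} (hl : G.IsTopOrder l)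
    (hirr : ∀ v, (v, v) ∉ G.edges) (hmem : ∀ e ∈ G.edges, e.1 ∈ G.verts ∧ e.2 ∈ G.verts)
    {v w : ℕ} (h : (v, w) ∈ G.edges) : l.idxOf v < l.idxOf w := by
  have hv : v ∈ l := (hl.2.1 v).mpr (hmem _ h).1
  have hw : w ∈ l := (hl.2.1 w).mpr (hmem _ h).2
  rcases lt_trichotomy (l.idxOf v) (l.idxOf w) with hlt | heq | hgt
  · exact hlt
  · have : v = w := (List.idxOf_inj hv).mp heq
    subst this
    exact absurd h (hirr v)
  · have := List.pairwise_iff_getElem.mp hl.2.2 _ _ (List.idxOf_lt_length_of_mem hw)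
      (List.idxOf_lt_length_of_mem hv) hgt
    rw [List.getElem_idxOf, List.getElem_idxOf] at this
    exact absurd h this

theorem Good.isPCOAST {G : Graph n κ} (h : G.Good) : G.IsPCOAST := by
  refine ⟨h.wf, h.edges_mem, fun v hv => ?_, h.edge_iff⟩
  obtain ⟨l, hl⟩ := h.order
  have : ∀ a b, Relation.TransGen (fun a b => (a, b) ∈ G.edges) a b → l.idxOf a < l.idxOf b := by
    intro a b hab
    induction hab with
    | single h1 => exact hl.idxOf_lt h.irrefl h.edges_mem h1
    | tail _ h1 ih => exact ih.trans (hl.idxOf_lt h.irrefl h.edges_mem h1)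
  exact lt_irrefl _ (this v v hv)

theorem good_empty : (Graph.empty : Graph n κ).Good where
  pauli := by simp [Graph.empty]
  wf := by simp [Graph.empty]
  edges_mem := by simp [Graph.empty]
  irrefl := by simp [Graph.empty]
  edge_iff := by simp [Graph.empty]
  mvar_inj := by simp [Graph.empty]
  order := ⟨[], by simp [IsTopOrder, Graph.empty]⟩

theorem Good.remove {G : Graph n κ} (h : G.Good) (v : ℕ) : (G.remove v).Good where
  pauli w hw := h.pauli w (Finset.mem_of_mem_erase hw)
  wf w hw := h.wf w (Finset.mem_of_mem_erase hw)
  edges_mem e he := ⟨Finset.mem_erase.mpr ⟨he.2.1, (h.edges_mem e he.1).1⟩,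
    Finset.mem_erase.mpr ⟨he.2.2, (h.edges_mem e he.1).2⟩⟩
  irrefl w hw := h.irrefl w hw.1
  edge_iff a ha b hb hab := by
    obtain ⟨hav, ha⟩ := Finset.mem_erase.mp ha
    obtain ⟨hbv, hb⟩ := Finset.mem_erase.mp hb
    have := h.edge_iff a ha b hb hab
    simpa [Graph.remove, hav, hbv] using this
  mvar_inj a ha b hb := h.mvar_inj a (Finset.mem_of_mem_erase ha) b (Finset.mem_of_mem_erase hb)
  order := by
    obtain ⟨l, h1, h2, h3⟩ := h.order
    refine ⟨l.filter (· ≠ v), h1.filter _, fun w => ?_, ?_⟩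
    · simp [Graph.remove, h2, and_comm]
    · exact (h3.filter _).imp fun hab hba => hab hba.1

theorem mvars_remove {G : Graph n κ} {v : ℕ} {c : κ} (hc : c ∈ (G.remove v).mvars) :
    c ∈ G.mvars := by
  obtain ⟨w, hw, hwc⟩ := hc
  exact ⟨w, Finset.mem_of_mem_erase hw, hwc⟩

/-- A vertex of outdegree `0` can be listed last. -/
theorem IsTopOrder.append_removed {G : Graph n κ} {v : ℕ} (hv : v ∈ G.verts)
    (hout : ∀ w, (v, w) ∉ G.edges) {l : List ℕ} (hl : (G.remove v).IsTopOrder l) :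
    G.IsTopOrder (l ++ [v]) := by
  obtain ⟨h1, h2, h3⟩ := hl
  have hm : ∀ w, w ∈ l ↔ w ≠ v ∧ w ∈ G.verts := fun w => (h2 w).trans Finset.mem_erase
  refine ⟨?_, fun w => ?_, ?_⟩
  · refine h1.append (List.nodup_singleton v) ?_
    intro w hw hwv
    exact ((hm w).mp hw).1 (List.mem_singleton.mp hwv)
  · rw [List.mem_append, List.mem_singleton, hm]
    by_cases hw : w = v
    · subst hw; simp [hv]
    · simp [hw]
  · rw [List.pairwise_append]
    refine ⟨?_, List.pairwise_singleton _ _, fun a _ b hb => ?_⟩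
    · refine h3.imp_of_mem fun {a b} ha hb hab hba => hab ⟨hba, ?_, ?_⟩
      · exact ((hm b).mp hb).1
      · exact ((hm a).mp ha).1
    · rw [List.mem_singleton.mp hb]; exact hout a

theorem newVertex_not_mem (G : Graph n κ) : G.newVertex ∉ G.verts := by
  intro h
  have : G.newVertex ≤ G.verts.sup id := Finset.le_sup (f := id) h
  rw [newVertex] at this
  omega

theorem insert_label_new (G : Graph n κ) (nd : Node n κ) :
    (G.insert nd).label G.newVertex = nd := Function.update_self _ _ _

theorem insert_label_of_mem {G : Graph n κ} (nd : Node n κ) {v : ℕ} (hv : v ∈ G.verts) :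
    (G.insert nd).label v = G.label v :=
  Function.update_of_ne (fun h : v = G.newVertex => G.newVertex_not_mem (h ▸ hv)) _ _

theorem insert_mem_edges {G : Graph n κ} (nd : Node n κ) (e : ℕ × ℕ) :
    e ∈ (G.insert nd).edges ↔ e ∈ G.edges ∨
      (e.1 ∈ G.verts ∧ e.2 = G.newVertex ∧ ¬ (G.label e.1).Comm nd) := Iff.rfl

theorem mem_insert_verts {G : Graph n κ} (nd : Node n κ) (v : ℕ) :
    v ∈ (G.insert nd).verts ↔ v = G.newVertex ∨ v ∈ G.verts := Finset.mem_insert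

theorem mvars_insert {G : Graph n κ} {nd : Node n κ} {c : κ} (hc : c ∈ (G.insert nd).mvars) :
    c ∈ G.mvars ∨ nd.mvar = some c := by
  obtain ⟨w, hw, hwc⟩ := hc
  rcases (mem_insert_verts nd w).mp hw with rfl | hw
  · rw [insert_label_new] at hwc; exact Or.inr hwc
  · rw [insert_label_of_mem nd hw] at hwc; exact Or.inl ⟨w, hw, hwc⟩

theorem Good.insert {G : Graph n κ} (h : G.Good) {nd : Node n κ} (hp : nd.IsPauliNode)
    (hw : nd.WF) (hv : ∀ c, nd.mvar = some c → c ∉ G.mvars) : (G.insert nd).Good := by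
  have hnew := G.newVertex_not_mem
  have hne : ∀ v ∈ G.verts, v ≠ G.newVertex := fun v hv h => hnew (h ▸ hv)
  have hnew1 : ∀ w, (G.newVertex, w) ∉ G.edges := fun w h' => hnew (h.edges_mem _ h').1
  have hnew2 : ∀ w, (w, G.newVertex) ∉ G.edges := fun w h' => hnew (h.edges_mem _ h').2
  constructor
  · intro v hv
    rcases (mem_insert_verts nd v).mp hv with rfl | hv
    · rwa [insert_label_new]
    · rw [insert_label_of_mem nd hv]; exact h.pauli v hv
  · intro v hv
    rcases (mem_insert_verts nd v).mp hv with rfl | hv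
    · rwa [insert_label_new]
    · rw [insert_label_of_mem nd hv]; exact h.wf v hv
  · intro e he
    simp only [mem_insert_verts]
    rcases he with he | he
    · exact ⟨Or.inr (h.edges_mem e he).1, Or.inr (h.edges_mem e he).2⟩
    · exact ⟨Or.inr he.1, Or.inl he.2.1⟩
  · intro v hv
    rcases hv with hv | hv
    · exact h.irrefl v hv
    · exact hne v hv.1 hv.2.1
  · intro v hv w hw' hvw
    rcases (mem_insert_verts nd v).mp hv with rfl | hv <;>
      rcases (mem_insert_verts nd w).mp hw' with rfl | hw'
    · exact absurd rfl hvw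
    · rw [insert_label_new, insert_label_of_mem nd hw', Node.comm_symm hp (h.pauli w hw')]
      simp only [insert_mem_edges, hnew1, hnew2, hnew, hw', Xor]
      simp
    · rw [insert_label_new, insert_label_of_mem nd hv]
      simp only [insert_mem_edges, hnew1, hnew2, hnew, hv, Xor]
      simp
    · rw [insert_label_of_mem nd hv, insert_label_of_mem nd hw']
      simpa [insert_mem_edges, hne v hv, hne w hw'] using h.edge_iff v hv w hw' hvw
  · intro v hv' w hw' c h1 h2
    rcases (mem_insert_verts nd v).mp hv' with rfl | hv' <;>
      rcases (mem_insert_verts nd w).mp hw' with rfl | hw'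
    · rfl
    · rw [insert_label_new] at h1; rw [insert_label_of_mem nd hw'] at h2
      exact absurd ⟨w, hw', h2⟩ (hv c h1)
    · rw [insert_label_new] at h2; rw [insert_label_of_mem nd hv'] at h1
      exact absurd ⟨v, hv', h1⟩ (hv c h2)
    · rw [insert_label_of_mem nd hv'] at h1; rw [insert_label_of_mem nd hw'] at h2
      exact h.mvar_inj v hv' w hw' c h1 h2
  · obtain ⟨l, h1, h2, h3⟩ := h.order
    refine ⟨l ++ [G.newVertex], ?_, fun w => ?_, ?_⟩
    · refine h1.append (List.nodup_singleton _) ?_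
      intro w hw hwv
      exact hne w ((h2 w).mp hw) (List.mem_singleton.mp hwv)
    · rw [List.mem_append, List.mem_singleton, mem_insert_verts, h2, or_comm]
    · rw [List.pairwise_append]
      refine ⟨?_, List.pairwise_singleton _ _, fun a _ b hb => ?_⟩
      · refine h3.imp_of_mem fun {a b} ha hb hab => ?_
        simpa [insert_mem_edges, hne a ((h2 a).mp ha)] using hab
      · rw [List.mem_singleton.mp hb]
        simp [insert_mem_edges, hnew, hnew1]

/-- In a topological order of `G.insert nd`, the new node commutes with all nodes that are listed
after it, and can be executed last. -/
theorem exists_topOrder_of_insert [DecidableEq κ] {G : Graph n κ} (h : G.Good) {nd : Node n κ}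
    (hp : nd.IsPauliNode) (hv : ∀ c, nd.mvar = some c → c ∉ G.mvars) {l' : List ℕ}
    (hl' : (G.insert nd).IsTopOrder l') : ∃ l, G.IsTopOrder l ∧
      ∀ γ, nd.sem (termSem (G.termOf l) γ) = termSem ((G.insert nd).termOf l') γ := by
  obtain ⟨h1, h2, h3⟩ := hl'
  obtain ⟨a, b, rfl⟩ := List.append_of_mem ((h2 _).mpr (Finset.mem_insert_self _ _))
  have hperm : (a ++ G.newVertex :: b).Perm (G.newVertex :: (a ++ b)) := List.perm_middle
  have hnd := List.nodup_cons.mp (hperm.nodup_iff.mp h1)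
  have hmem : ∀ w, w ∈ a ++ b ↔ w ∈ G.verts := by
    intro w
    have hw := h2 w
    rw [hperm.mem_iff, List.mem_cons, mem_insert_verts] at hw
    by_cases hwn : w = G.newVertex
    · subst hwn
      exact ⟨fun h' => absurd h' hnd.1, fun h' => absurd h' G.newVertex_not_mem⟩
    · simpa only [hwn, false_or] using hw
  have hsub : (a ++ b).Sublist (a ++ G.newVertex :: b) :=
    List.Sublist.append_left (List.sublist_cons_self _ _) _
  refine ⟨a ++ b, ⟨hnd.2, hmem, (h3.sublist hsub).imp fun hxy hyx => hxy (Or.inl hyx)⟩,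
    fun γ => ?_⟩
  have hlabel : ∀ c : List ℕ, (∀ w ∈ c, w ∈ G.verts) → (G.insert nd).termOf c = G.termOf c :=
    fun c hc => List.map_congr_left fun w hw => insert_label_of_mem nd (hc w hw)
  have ha : ∀ w ∈ a, w ∈ G.verts := fun w hw => (hmem w).mp (List.mem_append_left _ hw)
  have hb : ∀ w ∈ b, w ∈ G.verts := fun w hw => (hmem w).mp (List.mem_append_right _ hw)
  have hsplit : (G.insert nd).termOf (a ++ G.newVertex :: b) =
      G.termOf a ++ ([nd] ++ G.termOf b) := by
    rw [← hlabel a ha, ← hlabel b hb]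
    simp [termOf, insert_label_new]
  have hsplit' : G.termOf (a ++ b) = G.termOf a ++ G.termOf b := by simp [termOf]
  rw [hsplit, hsplit', termSem_append, termSem_append, termSem_append, termSem_singleton]
  refine (termSem_comm (fun c hc δ => ?_) _).symm
  obtain ⟨w, hw, rfl⟩ := List.mem_map.mp hc
  have hwG := hb w hw
  refine Node.sem_comm (h.pauli w hwG) hp ?_ (fun c hc hc' => hv c hc' ⟨w, hwG, hc⟩) δ
  by_contra hcomm
  have := (List.pairwise_cons.mp (List.pairwise_append.mp h3).2.1).1 w hw
  exact this (Or.inr ⟨hwG, rfl, hcomm⟩)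

end Graph

/-! ### Correctness of the compilation -/

section AddNode

variable {n : ℕ} {κ : Type*} [DecidableEq κ]

theorem addNode_frame (S : MergeSearch n κ) (G : Graph n κ) (F : Frame n) :
    addNode S G (.frame F) = (G, F, id) := by
  rw [addNode]

theorem addNode_of_pick_some {S : MergeSearch n κ} {G : Graph n κ} {nd : Node n κ}
    (hp : nd.IsPauliNode) {v : ℕ} {n₀ : Node n κ} {μ₀ : MFun κ}
    (h : S.pick G nd = some (v, n₀, μ₀)) :
    addNode S G nd = ((addNode S (G.remove v) n₀).1, (addNode S (G.remove v) n₀).2.1,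
      μ₀ ∘ (addNode S (G.remove v) n₀).2.2) := by
  cases nd <;> first
    | exact hp.elim
    | rw [addNode]
      · split
        · next h' =>
          rw [h] at h'
          obtain ⟨rfl, rfl, rfl⟩ : _ ∧ _ ∧ _ := by simpa using h'
          rfl
        · next h' => rw [h] at h'; simp at h'
      all_goals simp

theorem addNode_of_pick_none {S : MergeSearch n κ} {G : Graph n κ} {nd : Node n κ}
    (hp : nd.IsPauliNode) (h : S.pick G nd = none) :
    addNode S G nd = (G.insert nd, Frame.origin, id) := by
  cases nd <;> first
    | exact hp.elim
    | rw [addNode]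
      · split
        · next h' => rw [h] at h'; simp at h'
        · rfl
      all_goals simp

/-- What `addNode` returns, as an equality `G; nd ≡ G'; F; μ`. The topological order of `G` is
allowed to depend on that of `G'`, which makes it unnecessary to compare different orders of the
same graph. -/
structure AddNodeSpec (G : Graph n κ) (nd : Node n κ) (r : Graph n κ × Frame n × MFun κ) :
    Prop where
  good : r.1.Good
  frame_wf : r.2.1.WF
  mvars : ∀ c ∈ r.1.mvars, c ∈ G.mvars ∨ nd.mvar = some c
  respects : ∀ s : Set κ, G.mvars ⊆ s → (∀ c, nd.mvar = some c → c ∈ s) → Respects s r.2.2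
  sem : ∀ l', r.1.IsTopOrder l' → ∃ l, G.IsTopOrder l ∧ ∀ γ,
    nd.sem (termSem (G.termOf l) γ) =
      muChan r.2.2 ((Node.frame r.2.1).sem (termSem (r.1.termOf l') γ))

theorem addNode_spec (S : MergeSearch n κ) {G : Graph n κ} {nd : Node n κ} (hG : G.Good)
    (hp : nd.IsPauliNode ∨ ∃ F, nd = .frame F) (hw : nd.WF)
    (hv : ∀ c, nd.mvar = some c → c ∉ G.mvars) : AddNodeSpec G nd (addNode S G nd) := by
  induction hk : G.verts.card using Nat.strong_induction_on generalizing G nd with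
  | _ k ih =>
  rcases hp with hp | ⟨F, rfl⟩
  · rcases hpick : S.pick G nd with _ | ⟨v, n₀, μ₀⟩
    · rw [addNode_of_pick_none hp hpick]
      refine ⟨hG.insert hp hw hv, Frame.origin_wf, fun c hc => Graph.mvars_insert hc,
        fun s _ _ => respects_id s, fun l' hl' => ?_⟩
      obtain ⟨l, hl, hsem⟩ := Graph.exists_topOrder_of_insert hG hp hv hl'
      refine ⟨l, hl, fun γ => ?_⟩
      rw [hsem, sem_frame_origin, muChan_id]
    · obtain ⟨hvG, hout, hstep⟩ := S.some_spec _ _ _ _ _ hpick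
      obtain ⟨w0, p0, hmv, hresp, hsem⟩ :=
        hstep.sound (hG.pauli v hvG) hp (hG.wf v hvG) hw
      have hmv' : ∀ c, n₀.mvar = some c → c ∈ G.mvars ∨ nd.mvar = some c := by
        intro c hc
        rcases hmv with h | h | h
        · rw [h] at hc; simp at hc
        · exact Or.inl ⟨v, hvG, h ▸ hc⟩
        · exact Or.inr (h ▸ hc)
      have hv0 : ∀ c, n₀.mvar = some c → c ∉ (G.remove v).mvars := by
        intro c hc hcR
        rcases hmv with h | h | h
        · rw [h] at hc; simp at hc
        · obtain ⟨w, hwR, hwc⟩ := hcR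
          obtain ⟨hne, hwG⟩ := Finset.mem_erase.mp hwR
          exact hne (hG.mvar_inj w hwG v hvG c hwc (h ▸ hc))
        · exact hv c (h ▸ hc) (Graph.mvars_remove hcR)
      have hlt : (G.remove v).verts.card < k := hk ▸ Finset.card_erase_lt_of_mem hvG
      have hr := ih _ hlt (hG.remove v) p0 w0 hv0 rfl
      rw [addNode_of_pick_some hp hpick]
      refine ⟨hr.good, hr.frame_wf, fun c hc => ?_, fun s h1 h2 => ?_, fun l' hl' => ?_⟩
      · rcases hr.mvars c hc with h | h
        · exact Or.inl (Graph.mvars_remove h)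
        · exact hmv' c h
      · refine (hresp s fun c hc => h1 ⟨v, hvG, hc⟩).comp
          (hr.respects s (fun c hc => h1 (Graph.mvars_remove hc)) fun c hc => ?_)
        exact (hmv' c hc).elim (fun h => h1 h) (h2 c)
      · obtain ⟨l, hl, hsem'⟩ := hr.sem l' hl'
        refine ⟨l ++ [v], Graph.IsTopOrder.append_removed hvG hout hl, fun γ => ?_⟩
        have h1 : G.termOf (l ++ [v]) = (G.remove v).termOf l ++ [G.label v] := by
          simp [Graph.termOf, Graph.remove]
        rw [h1, termSem_append, termSem_singleton, hsem, hsem', ← muChan_comp]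
  · rw [addNode_frame]
    refine ⟨hG, hw, fun c hc => Or.inl hc, fun s _ _ => respects_id s, fun l' hl' =>
      ⟨l', hl', fun γ => ?_⟩⟩
    rw [muChan_id]

end AddNode

section Compile

variable {n : ℕ} {ν : Type*} [DecidableEq ν]

/-- The program variables and the fresh variables below `k`. -/
def varsBelow (ν : Type*) (k : ℕ) : Set (ν ⊕ ℕ) := {c | ∀ j, c = Sum.inr j → j < k}

/-- The loop invariant of the compilation: the configuration is equivalent, up to the fresh
variables, to the channel `Φ` of the nodes processed so far. The field `respects` says that the
measurement space function does not read the fresh variables that are still unused. -/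
structure Config.Inv (s : Config n ν) (Φ : CQ n ν → CQ n ν) : Prop where
  good : s.graph.Good
  frame_wf : s.frame.WF
  mvars : ∀ c ∈ s.graph.mvars, ∃ k < s.next, c = Sum.inr k
  respects : ∀ k, s.next ≤ k → Respects (varsBelow ν k) s.mfun
  sem : ∀ l, s.graph.IsTopOrder l → ∀ δ, Φ (muChan dropFresh δ) = muChan dropFresh
    (muChan s.mfun ((Node.frame s.frame).sem (termSem (s.graph.termOf l) δ)))

theorem Node.fwd_isPauliNode {κ : Type*} {nd : Node n κ} (h : nd.IsPauliNode) (F : Frame n) :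
    (nd.fwd F).IsPauliNode := by
  cases nd <;> exact h

theorem Node.fwd_mvar {κ : Type*} (nd : Node n κ) (F : Frame n) : (nd.fwd F).mvar = nd.mvar := by
  cases nd <;> rfl

theorem Node.fwd_wf {κ : Type*} {nd : Node n κ} (hp : nd.IsPauliNode) (h : nd.WF) {F : Frame n}
    (hF : F.WF) : (nd.fwd F).WF := by
  have hU := Frame.isUnitaryOf_unitary hF
  cases nd with
  | rot P θ => exact hU.herm_act h
  | prep PZ PX => exact ⟨hU.herm_act h.1, hU.herm_act h.2.1, (hU.lam_act _ _).trans h.2.2⟩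
  | meas c P => exact hU.herm_act h
  | frame F => exact hp.elim
  | mu μ => exact hp.elim

theorem Config.add_inv (S : MergeSearch n (ν ⊕ ℕ)) (s : Config n ν) {nd : Node n (ν ⊕ ℕ)}
    (hp : nd.IsPauliNode) (hw : nd.WF)
    (hnew : ∀ c, nd.mvar = some c → c ∉ s.graph.mvars ∧ ∃ k < s.next, c = Sum.inr k)
    (good : s.graph.Good) (frame_wf : s.frame.WF)
    (mvars : ∀ c ∈ s.graph.mvars, ∃ k < s.next, c = Sum.inr k)
    (respects : ∀ k, s.next ≤ k → Respects (varsBelow ν k) s.mfun)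
    {Φ : CQ n ν → CQ n ν}
    (sem : ∀ l, s.graph.IsTopOrder l → ∀ δ, Φ (muChan dropFresh δ) = muChan dropFresh
      (muChan s.mfun (nd.sem ((Node.frame s.frame).sem (termSem (s.graph.termOf l) δ))))) :
    (s.add S nd).Inv Φ := by
  have hmv := nd.fwd_mvar s.frame
  have hr := addNode_spec S good (Or.inl (nd.fwd_isPauliNode hp s.frame))
    (Node.fwd_wf hp hw frame_wf) (fun c hc => (hnew c (hmv ▸ hc)).1)
  have hbelow : ∀ k, s.next ≤ k → ∀ c : ν ⊕ ℕ, (∃ j < s.next, c = Sum.inr j) →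
      c ∈ varsBelow ν k := by
    rintro k hk c ⟨j, hj, rfl⟩ i hi
    rw [← Sum.inr.inj hi]; omega
  refine ⟨hr.good, Frame.comp_wf hr.frame_wf frame_wf, fun c hc => ?_, fun k hk => ?_,
    fun l' hl' δ => ?_⟩
  · rcases hr.mvars c hc with h | h
    · exact mvars c h
    · exact (hnew c (hmv ▸ h)).2
  · refine (respects k hk).comp (hr.respects _ (fun c hc => hbelow k hk c (mvars c hc)) ?_)
    exact fun c hc => hbelow k hk c (hnew c (hmv ▸ hc)).2
  · obtain ⟨l, hl, hsem⟩ := hr.sem l' hl'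
    rw [sem l hl, sem_fwd frame_wf hp, hsem, sem_frame_muChan, sem_frame_comp hr.frame_wf frame_wf,
      ← muChan_comp s.mfun]
    rfl

/-- A measurement after `μ` can record its outcome in a fresh variable before `μ`, if `μ` copies it
from there. -/
theorem sem_meas_redirect {μ : MFun (ν ⊕ ℕ)} {k : ℕ} (hμ : Respects (varsBelow ν k) μ) (c : ν)
    (P : Pauli n) (γ : CQ n (ν ⊕ ℕ)) :
    (Node.meas c P).sem (muChan dropFresh (muChan μ γ)) =
      muChan dropFresh (muChan (redirect μ (Sum.inl c) (Sum.inr k))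
        ((Node.meas (Sum.inr k) P).sem γ)) := by
  refine cq_hom_ext (f := (Node.meas c P).semHom.comp ((muHom dropFresh).comp (muHom μ)))
    (g := (muHom dropFresh).comp ((muHom (redirect μ (Sum.inl c) (Sum.inr k))).comp
      (Node.meas (Sum.inr k) P).semHom)) (fun m ρ => ?_) γ
  have h : ∀ b, dropFresh (redirect μ (Sum.inl c) (Sum.inr k) (assign m (Sum.inr k) b)) =
      assign (dropFresh (μ m)) c b := by
    intro b
    funext d
    have hd : μ (assign m (Sum.inr k) b) (Sum.inl d) = μ m (Sum.inl d) := by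
      refine hμ _ _ (fun e he => ?_) _ (by simp [varsBelow])
      have hek : e ≠ Sum.inr k := fun h => lt_irrefl k (he k h)
      simp [assign, hek]
    by_cases hdc : d = c
    · subst hdc; simp [dropFresh, redirect, assign]
    · have hdc' : (Sum.inl d : ν ⊕ ℕ) ≠ Sum.inl c := fun h => hdc (Sum.inl.inj h)
      simpa [dropFresh, redirect, assign, hdc, hdc'] using hd
  simp only [AddMonoidHom.comp_apply, muHom_single, semHom_meas_single, map_add, h]

omit [DecidableEq ν] in
theorem respects_liftMFun (μ : MFun ν) (k : ℕ) : Respects (varsBelow ν k) (liftMFun μ) := by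
  intro m m' h c hc
  have h1 : (fun d => m (Sum.inl d)) = fun d => m' (Sum.inl d) :=
    funext fun d => h _ (by simp [varsBelow])
  cases c with
  | inl d => simp [liftMFun, h1]
  | inr j => exact h _ hc

theorem Config.step_inv (S : MergeSearch n (ν ⊕ ℕ)) {s : Config n ν} {Φ : CQ n ν → CQ n ν}
    (h : s.Inv Φ) {nd : Node n ν} (hw : nd.WF) :
    (s.step S nd).Inv fun γ => nd.sem (Φ γ) := by
  cases nd with
  | rot P θ =>
    refine Config.add_inv S s (nd := .rot P θ) trivial hw (by simp [Node.mvar]) h.good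
      h.frame_wf h.mvars h.respects fun l hl δ => ?_
    rw [h.sem l hl, sem_rot_muChan, sem_rot_muChan]
  | prep PZ PX =>
    refine Config.add_inv S s (nd := .prep PZ PX) trivial hw (by simp [Node.mvar]) h.good
      h.frame_wf h.mvars h.respects fun l hl δ => ?_
    rw [h.sem l hl, sem_prep_muChan, sem_prep_muChan]
  | meas c P =>
    refine Config.add_inv S ⟨s.graph, s.frame, redirect s.mfun (Sum.inl c) (Sum.inr s.next),
      s.next + 1⟩ (nd := .meas (Sum.inr s.next) P) trivial hw (fun d hd => ?_) h.good
      h.frame_wf (fun d hd => ?_) (fun k hk => ?_) fun l hl δ => ?_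
    · obtain rfl : Sum.inr s.next = d := Option.some.inj hd
      refine ⟨fun hm => ?_, s.next, Nat.lt_succ_self _, rfl⟩
      obtain ⟨k, hk, hk'⟩ := h.mvars _ hm
      exact absurd (Sum.inr.inj hk') hk.ne'
    · obtain ⟨k, hk, hk'⟩ := h.mvars d hd
      exact ⟨k, Nat.lt_succ_of_lt hk, hk'⟩
    · have hk' : s.next < k := hk
      refine respects_assign (h.respects k hk'.le) _ fun m m' hm => hm _ fun j hj => ?_
      rw [← Sum.inr.inj hj]; exact hk'
    · rw [h.sem l hl, sem_meas_redirect (h.respects s.next le_rfl)]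
  | frame F =>
    refine ⟨h.good, Frame.comp_wf h.frame_wf hw, h.mvars, h.respects, fun l hl δ => ?_⟩
    simp only [h.sem l hl, Config.step]
    rw [← sem_frame_comp h.frame_wf hw, sem_frame_muChan, sem_frame_muChan]
  | mu μ =>
    refine ⟨h.good, h.frame_wf, h.mvars,
      fun k hk => (respects_liftMFun μ k).comp (h.respects k hk), fun l hl δ => ?_⟩
    simp only [h.sem l hl, Config.step]
    change muChan μ _ = _
    rw [← muChan_comp, ← muChan_comp, ← muChan_comp]
    rfl

theorem Config.foldl_step_inv (S : MergeSearch n (ν ⊕ ℕ)) {t : Term n ν} (ht : ∀ nd ∈ t, nd.WF)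
    {s : Config n ν} {Φ : CQ n ν → CQ n ν} (h : s.Inv Φ) :
    (t.foldl (fun s nd => s.step S nd) s).Inv fun γ => termSem t (Φ γ) := by
  induction t generalizing s Φ with
  | nil => exact h
  | cons nd t ih =>
    exact ih (fun a ha => ht a (List.mem_cons_of_mem _ ha))
      (Config.step_inv S h (ht nd List.mem_cons_self))

theorem circuit_inv {Γ : Type*} (chan : Γ → CQ n ν → CQ n ν) (gateTerm : Γ → Term n ν)
    (S : MergeSearch n (ν ⊕ ℕ)) {C : List Γ} (hC : ∀ g ∈ C, Represents (gateTerm g) (chan g))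
    {s : Config n ν} {Φ : CQ n ν → CQ n ν} (h : s.Inv Φ) :
    (C.foldl (fun s g => (gateTerm g).foldl (fun s nd => s.step S nd) s) s).Inv
      fun γ => circuitSem chan C (Φ γ) := by
  induction C generalizing s Φ with
  | nil => exact h
  | cons g C ih =>
    have hg := hC g List.mem_cons_self
    have h1 := Config.foldl_step_inv S hg.1 h
    simp only [← hg.2] at h1
    exact ih (fun a ha => hC a (List.mem_cons_of_mem _ ha)) h1

theorem initial_inv :
    (⟨Graph.empty, Frame.origin, id, 0⟩ : Config n ν).Inv fun γ => γ := by
  refine ⟨Graph.good_empty, Frame.origin_wf, fun c hc => ?_, fun k _ => respects_id _,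
    fun l hl δ => ?_⟩
  · obtain ⟨v, hv, _⟩ := hc
    exact absurd hv (Finset.notMem_empty v)
  · have hl' : l = [] := List.eq_nil_iff_forall_not_mem.mpr fun v hv =>
      Finset.notMem_empty v ((hl.2.1 v).mp hv)
    subst hl'
    rw [sem_frame_origin, muChan_id]
    rfl

end Compile

end PCOAST

end

theorem mainTheorem2 {n : ℕ} {ν : Type*} [DecidableEq ν] {Γ : Type*}
    (chan : Γ → PCOAST.CQ n ν → PCOAST.CQ n ν) (gateTerm : Γ → PCOAST.Term n ν)
    (S : PCOAST.MergeSearch n (ν ⊕ ℕ)) (C : List Γ)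
    (hC : ∀ g ∈ C, PCOAST.Represents (gateTerm g) (chan g)) :
    ∃ (G : PCOAST.Graph n (ν ⊕ ℕ)) (F : PCOAST.Frame n) (μ : PCOAST.MFun (ν ⊕ ℕ)) (k : ℕ),
      PCOAST.circuitToPoPR S gateTerm C = ⟨G, F, μ, k⟩ ∧
      G.IsPCOAST ∧ (∀ v ∈ G.verts, (G.label v).IsPauliNode) ∧ F.WF ∧
      (∃ l, G.IsTopOrder l) ∧
      ∀ l, G.IsTopOrder l →
        PCOAST.EquivModFresh (PCOAST.circuitSem chan C)
          (G.termOf l ++ [PCOAST.Node.frame F, PCOAST.Node.mu μ]) := by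
  have h := PCOAST.circuit_inv chan gateTerm S hC PCOAST.initial_inv
  refine ⟨_, _, _, _, rfl, h.good.isPCOAST, h.good.pauli, h.frame_wf, h.good.order,
    fun l hl δ => ?_⟩
  rw [PCOAST.termSem_append]
  exact h.sem l hl δ
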